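/- Let $n\ge 1$ and $\Gamma_n=\langle a,b\mid [a^n,b]=1\rangle$. For $r\ge 1$ let $R_r=\mathrm{Hom}(\Gamma_n,\mathrm U(r))=\{(A,B)\in \mathrm U(r)^2 \mid [A^n,B]=\mathrm{Id}\}$, a compact real algebraic set in $M_r(\mathbb C)^2$, and let $X_r=R_r/\!/\mathrm U(r)$ be its quotient by conjugation: the points of $X_r$ are the equivalence classes of representations, its topology is the quotient topology, and its regular functions are the conjugation-invariant real-valued regular functions on $R_r$. (A real-valued function is regular on $R_r$ if it is locally, in the Zariski topology, a fraction of real polynomials in the real and imaginary parts of the matrix entries of $A$ and $B$.) Let $X_r^*\subset X_r$ be the set of classes of irreducible representations. For a space $Y$ let $\mathrm{Sym}^a(Y)=Y^a/S_a$. Subsets, finite products and quotients by finite groups carry the induced topologies and regular functions: on a subset, local fractions of restrictions; on a product, local fractions of polynomials in the regular functions of the factors; on a quotient, the invariant regular functions. Let $\pi=(r_1^{a_1},\dots,r_s^{a_s})$ be a partition of $r\ge 1$, that is, $r=a_1r_1+\dots+a_sr_s$ with integers $r_1>r_2>\dots>r_s>0$ and $a_i\ge 0$, and let $X_r^\pi\subset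 X_r$ be the set of classes of the representations of the form $$\rho=\bigoplus_{t=1}^{s}\bigoplus_{l=1}^{a_t}\rho_{tl},\qquad \rho_{tl}:\Gamma_n\to \mathrm U(r_t)\ \text{ irreducible}.$$ Then there is an isomorphism $$\prod_{i=1}^s \mathrm{Sym}^{a_i}(X_{r_i}^*)\;\cong\; X_r^\pi ,$$ namely, the map that sends the tuple of unordered collections $\{[\rho_{i1}],\dots,[\rho_{ia_i}]\}$, $i=1,\dots,s$, to the class of $\bigoplus_{i,l}\rho_{il}$ is a well-defined bijection, a homeomorphism, and identifies the real-valued regular functions on both sides. -/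

import Mathlib

noncomputable section

namespace TwistedHopf

/-! ### Real algebraic structures, recorded by their algebras of regular functions -/

/-- The functions on `Y` that are locally fractions of functions in `𝒜`. Replacing `P / Q` on a basic
Zariski open set `{R ≠ 0}` by `P Q R / (Q ^ 2 R)`, one may ask for `Q * f = P` on all of `Y`. -/
def localFractions {Y : Type*} (𝒜 : Subalgebra ℝ (Y → ℝ)) : Subalgebra ℝ (Y → ℝ) where
  carrier := {f | ∀ x, ∃ P ∈ 𝒜, ∃ Q ∈ 𝒜, Q x ≠ 0 ∧ ∀ y, Q y * f y = P y}
  mul_mem' := by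
    intro f g hf hg x
    obtain ⟨P, hP, Q, hQ, hx, h⟩ := hf x
    obtain ⟨P', hP', Q', hQ', hx', h'⟩ := hg x
    refine ⟨P * P', mul_mem hP hP', Q * Q', mul_mem hQ hQ', mul_ne_zero hx hx', fun y => ?_⟩
    simp only [Pi.mul_apply, ← h, ← h']
    ring
  add_mem' := by
    intro f g hf hg x
    obtain ⟨P, hP, Q, hQ, hx, h⟩ := hf x
    obtain ⟨P', hP', Q', hQ', hx', h'⟩ := hg x
    refine ⟨P * Q' + P' * Q, add_mem (mul_mem hP hQ') (mul_mem hP' hQ), Q * Q', mul_mem hQ hQ',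
      mul_ne_zero hx hx', fun y => ?_⟩
    simp only [Pi.mul_apply, Pi.add_apply, ← h, ← h']
    ring
  algebraMap_mem' := fun c x =>
    ⟨algebraMap ℝ _ c, 𝒜.algebraMap_mem c, 1, 𝒜.one_mem, by simp, fun y => by simp⟩

/-- A space with its algebra of real-valued regular functions. -/
class RegularFunctions (Y : Type*) where
  /-- the regular functions `Y → ℝ` -/
  algebra : Subalgebra ℝ (Y → ℝ)

/-- `f` is a regular function on `Y`. -/
def IsRegular {Y : Type*} [RegularFunctions Y] (f : Y → ℝ) : Prop :=
  f ∈ RegularFunctions.algebra (Y := Y)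

/-- Composition of real functions with `φ`, as a homomorphism of algebras. -/
def pullback {Y Z : Type*} (φ : Y → Z) : (Z → ℝ) →ₐ[ℝ] (Y → ℝ) where
  toFun f := f ∘ φ
  map_one' := rfl
  map_mul' _ _ := rfl
  map_zero' := rfl
  map_add' _ _ := rfl
  commutes' _ := rfl

/-- Regular functions on a quotient are the invariant regular functions. -/
instance quotientRegular {Y : Type*} [RegularFunctions Y] (s : Setoid Y) : RegularFunctions (Quotient s) where
  algebra := RegularFunctions.algebra.comap (pullback (Quotient.mk s))

/-- Regular functions on a subset are the local fractions of restrictions of regular functions. -/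
instance subtypeRegular {Y : Type*} [RegularFunctions Y] (p : Y → Prop) : RegularFunctions (Subtype p) where
  algebra := localFractions (RegularFunctions.algebra.map (pullback (Subtype.val : Subtype p → Y)))

/-- Regular functions on a product are the local fractions of polynomials in the regular functions
of the factors. -/
instance productRegular {κ : Type*} {Y : κ → Type*} [∀ k, RegularFunctions (Y k)] :
    RegularFunctions (∀ k, Y k) where
  algebra := localFractions (Algebra.adjoin ℝ
    {F | ∃ k, ∃ f : Y k → ℝ, IsRegular f ∧ F = fun y => f (y k)})

/-- A bijection that identifies the regular functions on both sides. -/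
def IsBiregular {Y Z : Type*} [RegularFunctions Y] [RegularFunctions Z] (Φ : Y ≃ Z) : Prop :=
  ∀ f : Z → ℝ, IsRegular f ↔ IsRegular (f ∘ Φ)

/-! ### Symmetric products -/

/-- Two `a`-tuples are equivalent if a permutation of the indices carries one to the other. -/
def permSetoid (Y : Type*) (a : ℕ) : Setoid (Fin a → Y) where
  r f g := ∃ σ : Equiv.Perm (Fin a), g = f ∘ σ
  iseqv :=
    { refl := fun _ => ⟨1, rfl⟩
      symm := by
        rintro f g ⟨σ, rfl⟩
        exact ⟨σ⁻¹, by ext; simp⟩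
      trans := by
        rintro f g h ⟨σ, rfl⟩ ⟨τ, rfl⟩
        exact ⟨σ * τ, rfl⟩ }

/-- The symmetric product `Sym^a(Y) = Y^a / S_a`, with the quotient topology. -/
abbrev SymProd (Y : Type*) (a : ℕ) : Type _ := Quotient (permSetoid Y a)

/-! ### Unitary representations of the twisted Hopf link group -/

/-- The relator `[a ^ n, b]` in the free group on the generators `a = 0` and `b = 1`. -/
def relator (n : ℕ) : FreeGroup (Fin 2) :=
  FreeGroup.of 0 ^ n * FreeGroup.of 1 * (FreeGroup.of 0 ^ n)⁻¹ * (FreeGroup.of 1)⁻¹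

/-- `Γ_n = ⟨a, b ∣ [a ^ n, b] = 1⟩`, with generators `a = 0` and `b = 1`. -/
abbrev LinkGroup (n : ℕ) : Type := PresentedGroup {relator n}

/-- The generators of `Γ_n`. -/
def gen (n : ℕ) (j : Fin 2) : LinkGroup n := PresentedGroup.of j

/-- The representation space `Hom(Γ_n, U(r))`. -/
abbrev Rep (n r : ℕ) : Type := LinkGroup n →* Matrix.unitaryGroup (Fin r) ℂ

/-- `Hom(Γ_n, U(r))` is topologised as a subspace of `U(r) × U(r)`. -/
instance repTopology (n r : ℕ) : TopologicalSpace (Rep n r) :=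
  TopologicalSpace.induced (fun ρ => (ρ (gen n 0), ρ (gen n 1))) inferInstance

/-- Regular functions on the real algebraic set `Hom(Γ_n, U(r))`: the local fractions of real
polynomials in the real and imaginary parts of the entries of the two matrices. -/
instance repRegular (n r : ℕ) : RegularFunctions (Rep n r) where
  algebra := localFractions (Algebra.adjoin ℝ
    ({F | ∃ (j : Fin 2) (k l : Fin r),
        F = fun ρ : Rep n r => ((ρ (gen n j) : Matrix (Fin r) (Fin r) ℂ) k l).re} ∪
      {F | ∃ (j : Fin 2) (k l : Fin r),
        F = fun ρ : Rep n r => ((ρ (gen n j) : Matrix (Fin r) (Fin r) ℂ) k l).im}))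

/-- The underlying complex linear representation on `ℂ^r`. -/
def Rep.toRepresentation {n r : ℕ} (ρ : Rep n r) :
    Representation ℂ (LinkGroup n) (Fin r → ℂ) :=
  (Matrix.toLinAlgEquiv' (R := ℂ) (n := Fin r) : _ →* _).comp
    ((Matrix.unitaryGroup (Fin r) ℂ).subtype.comp ρ)

/-- `ρ` is irreducible: `ℂ^r ≠ 0` has no invariant subspaces but `0` and `ℂ^r`. -/
def Rep.IsIrreducible {n r : ℕ} (ρ : Rep n r) : Prop := ρ.toRepresentation.IsIrreducible

/-- Equivalence of representations: conjugation by an element of `U(r)`. -/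
def conjSetoid (n r : ℕ) : Setoid (Rep n r) where
  r ρ σ := ∃ g : Matrix.unitaryGroup (Fin r) ℂ, ∀ γ, σ γ = g * ρ γ * g⁻¹
  iseqv :=
    { refl := fun _ => ⟨1, by simp⟩
      symm := by
        rintro ρ σ ⟨g, h⟩
        exact ⟨g⁻¹, fun γ => by rw [h]; group⟩
      trans := by
        rintro ρ σ τ ⟨g, h⟩ ⟨g', h'⟩
        exact ⟨g' * g, fun γ => by rw [h', h]; group⟩ }

/-- The character variety `X_r = Hom(Γ_n, U(r)) // U(r)`. The group `U(r)` is compact, so that the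
points of the quotient are the orbits; the regular functions are the invariant ones. -/
abbrev CharVar (n r : ℕ) : Type := Quotient (conjSetoid n r)

/-- The class of a representation. -/
def Rep.cls {n r : ℕ} (ρ : Rep n r) : CharVar n r := Quotient.mk (conjSetoid n r) ρ

/-- The irreducible locus `X_r^*`. -/
def irrLocus (n r : ℕ) : Set (CharVar n r) := {x | ∃ ρ : Rep n r, ρ.IsIrreducible ∧ ρ.cls = x}

/-- The class of an irreducible representation as a point of `X_r^*`. -/
def irrCls {n r : ℕ} (ρ : Rep n r) (h : ρ.IsIrreducible) : irrLocus n r := ⟨ρ.cls, ρ, h, rfl⟩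

/-- The direct sum of unitary representations: block diagonal matrices, with the basis of the sum
numbered by `e`. -/
def directSum {n r : ℕ} {κ : Type} [Fintype κ] [DecidableEq κ] {m : κ → ℕ}
    (e : (Σ k, Fin (m k)) ≃ Fin r) (ρ : ∀ k, Rep n (m k)) : Rep n r where
  toFun γ := ⟨Matrix.reindex e e (Matrix.blockDiagonal' fun k =>
      (ρ k γ : Matrix (Fin (m k)) (Fin (m k)) ℂ)), by
    rw [Matrix.mem_unitaryGroup_iff, Matrix.star_eq_conjTranspose, Matrix.conjTranspose_reindex,
      Matrix.blockDiagonal'_conjTranspose]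
    simp only [Matrix.reindex_apply, Matrix.submatrix_mul_equiv, ← Matrix.blockDiagonal'_mul]
    have h : (fun k => (ρ k γ : Matrix (Fin (m k)) (Fin (m k)) ℂ) *
        (ρ k γ : Matrix (Fin (m k)) (Fin (m k)) ℂ).conjTranspose) = 1 := by
      funext k
      exact Matrix.mem_unitaryGroup_iff.mp (ρ k γ).2
    rw [h, Matrix.blockDiagonal'_one, Matrix.submatrix_one_equiv]⟩
  map_one' := by
    apply Subtype.ext
    have h : (fun k => (ρ k 1 : Matrix (Fin (m k)) (Fin (m k)) ℂ)) = 1 := by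
      funext k
      simp
    simp only [h, Matrix.blockDiagonal'_one, Matrix.reindex_apply, Matrix.submatrix_one_equiv]
    rfl
  map_mul' γ δ := by
    apply Subtype.ext
    simp [Matrix.submatrix_mul_equiv, Matrix.blockDiagonal'_mul]

/-- The stratum `X_r^π ⊆ X_r` of type `π = (d_1^{a_1}, …, d_s^{a_s})`: the classes of direct sums of
irreducible representations, `a_i` of which have dimension `d_i`. -/
def stratum (n r : ℕ) {s : ℕ} (d a : Fin s → ℕ) : Set (CharVar n r) :=
  {x | ∃ ρ : ∀ p : (Σ i, Fin (a i)), Rep n (d p.1), (∀ p, (ρ p).IsIrreducible) ∧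
    ∃ e : (Σ p : (Σ i, Fin (a i)), Fin (d p.1)) ≃ Fin r, (directSum e ρ).cls = x}

end TwistedHopf

end

/-! Tuples of irreducible representations (`IrrTup`) map onto both sides, by `symClass` and by
`sumClass`. The two maps have the same fibres, so bijectivity, topology and regular functions can
all be compared on this common cover.

The difficulty is that a function on the stratum sees only the whole direct sum, for instance its
total character, while the product of symmetric products sees the single summands up to permutation.
The bridge is an alternating form in `m * m` matrices of a representation, evaluated on group
elements (`capelli`). It is a linear combination of characters, hence additive over summands. It
vanishes in dimensions below `m`, and at each irreducible representation of dimension `m` some such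
form is nonzero. In dimension `m` the span of these forms is stable under multiplication by
characters (`chi_mul_capelli`). Going from the largest dimension downwards, one isolates the
summands of each dimension: every symmetrised product of functions of their characters is a local
fraction of total characters (`symSum_mem_fracAt`). Evaluated at a second tuple with the same total
character, this also gives uniqueness of the decomposition and shows that the second tuple is
irreducible as well.

The other ingredient of invariant theory is `mem_fracAt_famCharAlg`: at a tuple of irreducible
representations, a conjugation invariant local fraction of matrix entries is a local fraction of
characters. An element of the group algebra that is Hermitian in every representation and has
distinct eigenvalues at the given point cuts out a slice where it is diagonal. On the slice,
averages over a finite torus and over permutation matrices reduce entries to eigenvalues, and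
eigenvalues to traces. The spectral theorem carries the resulting identity back from the slice.

Equal characters give unitarily conjugate representations by positivity of `tr (z z*)`
(`exists_conj_of_chi_eq`). The inverse map is continuous because unitary groups are compact and
irreducibility of the summands can be read off the class of the sum. -/

namespace TwistedHopf

/-! ### Local fractions of complex valued functions -/

/-- The functions that are, on `U`, fractions of functions in `S` with denominator nonzero at `z₀`. -/
def fracAt {Z : Type*} (S : Subalgebra ℂ (Z → ℂ)) (U : Set Z) (z₀ : Z) : Subalgebra ℂ (Z → ℂ) where
  carrier := {f | ∃ P ∈ S, ∃ Q ∈ S, Q z₀ ≠ 0 ∧ ∀ y ∈ U, Q y * f y = P y}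
  mul_mem' := by
    rintro f g ⟨P, hP, Q, hQ, hx, h⟩ ⟨P', hP', Q', hQ', hx', h'⟩
    refine ⟨P * P', mul_mem hP hP', Q * Q', mul_mem hQ hQ', mul_ne_zero hx hx', fun y hy => ?_⟩
    simp only [Pi.mul_apply, ← h y hy, ← h' y hy]
    ring
  add_mem' := by
    rintro f g ⟨P, hP, Q, hQ, hx, h⟩ ⟨P', hP', Q', hQ', hx', h'⟩
    refine ⟨P * Q' + P' * Q, add_mem (mul_mem hP hQ') (mul_mem hP' hQ), Q * Q', mul_mem hQ hQ',
      mul_ne_zero hx hx', fun y hy => ?_⟩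
    simp only [Pi.mul_apply, Pi.add_apply, ← h y hy, ← h' y hy]
    ring
  algebraMap_mem' := fun c =>
    ⟨algebraMap ℂ _ c, S.algebraMap_mem c, 1, S.one_mem, by simp, fun y _ => by simp⟩

section fracAt

variable {Z : Type*} {S S' : Subalgebra ℂ (Z → ℂ)} {U U' : Set Z} {z₀ : Z}

theorem fracAt_of_eqOn {f g : Z → ℂ} (hg : g ∈ S) (h : ∀ y ∈ U, f y = g y) : f ∈ fracAt S U z₀ :=
  ⟨g, hg, 1, S.one_mem, by simp, fun y hy => by simp [h y hy]⟩

theorem le_fracAt : S ≤ fracAt S U z₀ := fun _ hf => fracAt_of_eqOn hf fun _ _ => rfl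

theorem fracAt_anti (h : U' ⊆ U) : fracAt S U z₀ ≤ fracAt S U' z₀ := by
  rintro f ⟨P, hP, Q, hQ, h0, H⟩
  exact ⟨P, hP, Q, hQ, h0, fun y hy => H y (h hy)⟩

/-- Local fractions are closed under division by `c` when `c z₀ ≠ 0`: the numerator of `c` is then
nonzero at `z₀`, which lies in `U`, and can join the denominator. -/
theorem fracAt_of_mul (hz : z₀ ∈ U) {c f g : Z → ℂ} (hc : c ∈ fracAt S U z₀)
    (hg : g ∈ fracAt S U z₀) (h0 : c z₀ ≠ 0) (h : ∀ y ∈ U, c y * f y = g y) :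
    f ∈ fracAt S U z₀ := by
  obtain ⟨P₁, hP₁, Q₁, hQ₁, h₁, H₁⟩ := hc
  obtain ⟨P₂, hP₂, Q₂, hQ₂, h₂, H₂⟩ := hg
  refine ⟨Q₁ * P₂, mul_mem hQ₁ hP₂, Q₂ * P₁, mul_mem hQ₂ hP₁, ?_, fun y hy => ?_⟩
  · rw [Pi.mul_apply, ← H₁ _ hz]
    exact mul_ne_zero h₂ (mul_ne_zero h₁ h0)
  · simp only [Pi.mul_apply, ← H₁ y hy, ← H₂ y hy, ← h y hy]
    ring

theorem fracAt_le_fracAt (hz : z₀ ∈ U) (h : S ≤ fracAt S' U z₀) :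
    fracAt S U z₀ ≤ fracAt S' U z₀ := by
  rintro f ⟨P, hP, Q, hQ, h0, H⟩
  exact fracAt_of_mul hz (h hQ) (h hP) h0 H

/-- Averaging the numerator and the denominator of an invariant local fraction over a finite family
of transformations. -/
theorem fracAt_of_average (hz : z₀ ∈ U) {ι : Type*} [Fintype ι] (w : ι → Z → Z)
    (hw : ∀ i, ∀ y ∈ U, w i y ∈ U) (i₀ : ι) (hi₀ : w i₀ z₀ = z₀) {P Q F : Z → ℂ}
    (hP : (fun y => ∑ i, (P * star Q) (w i y)) ∈ fracAt S' U z₀)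
    (hQ : (fun y => ∑ i, (Q * star Q) (w i y)) ∈ fracAt S' U z₀)
    (hF : ∀ i, ∀ y ∈ U, F (w i y) = F y) (h0 : Q z₀ ≠ 0) (H : ∀ y ∈ U, Q y * F y = P y) :
    F ∈ fracAt S' U z₀ := by
  refine fracAt_of_mul hz hQ hP ?_ fun y hy => ?_
  -- The factor `star Q` turns the averaged denominator at `z₀` into a sum of squares `|Q|²`, so
  -- nothing cancels; the term of `i₀` is positive.
  · have : (∑ i, (Q * star Q) (w i z₀)) = ((∑ i, Complex.normSq (Q (w i z₀)) : ℝ) : ℂ) := by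
      push_cast
      refine Finset.sum_congr rfl fun i _ => ?_
      simp [Complex.mul_conj]
    rw [this]
    refine Complex.ofReal_ne_zero.2 (ne_of_gt ?_)
    refine Finset.sum_pos' (fun i _ => Complex.normSq_nonneg _) ⟨i₀, Finset.mem_univ _, ?_⟩
    rw [hi₀]
    exact Complex.normSq_pos.2 h0
  · rw [Finset.sum_mul]
    refine Finset.sum_congr rfl fun i _ => ?_
    have := H _ (hw i y hy)
    rw [hF i y hy] at this
    simp only [Pi.mul_apply, ← this]
    ring

/-- Functions agreeing at two points agree on local fractions with denominator nonzero there. -/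
theorem eq_of_mem_fracAt {y : Z} (h : ∀ f ∈ S, f y = f z₀) {f : Z → ℂ}
    (hf : f ∈ fracAt S Set.univ z₀) : f y = f z₀ := by
  obtain ⟨P, hP, Q, hQ, h0, H⟩ := hf
  have h1 := H y trivial
  rw [h _ hQ, h _ hP, ← H z₀ trivial] at h1
  exact mul_left_cancel₀ h0 h1

end fracAt

theorem eqOn_adjoin {Z : Type*} {G : Set (Z → ℂ)} {y y' : Z} (h : ∀ f ∈ G, f y = f y')
    {f : Z → ℂ} (hf : f ∈ Algebra.adjoin ℂ G) : f y = f y' := by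
  induction hf using Algebra.adjoin_induction with
  | mem f hf => exact h f hf
  | algebraMap c => rfl
  | add f g _ _ hf hg => simp [hf, hg]
  | mul f g _ _ hf hg => simp [hf, hg]

theorem star_mem_adjoin {Z : Type*} {G : Set (Z → ℂ)} (h : ∀ f ∈ G, star f ∈ Algebra.adjoin ℂ G)
    {f : Z → ℂ} (hf : f ∈ Algebra.adjoin ℂ G) : star f ∈ Algebra.adjoin ℂ G := by
  induction hf using Algebra.adjoin_induction with
  | mem f hf => exact h f hf
  | algebraMap c =>
    have : star (algebraMap ℂ (Z → ℂ) c) = algebraMap ℂ (Z → ℂ) (star c) := by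
      ext; simp
    rw [this]
    exact Subalgebra.algebraMap_mem _ _
  | add f g _ _ hf hg => rw [star_add]; exact add_mem hf hg
  | mul f g _ _ hf hg => rw [star_mul]; exact mul_mem hg hf

/-- The complex valued functions with real and imaginary part in `𝒜`. -/
def complexify {Y : Type*} (𝒜 : Subalgebra ℝ (Y → ℝ)) : Subalgebra ℂ (Y → ℂ) where
  carrier := {f | (fun y => (f y).re) ∈ 𝒜 ∧ (fun y => (f y).im) ∈ 𝒜}
  mul_mem' := by
    rintro f g ⟨h1, h2⟩ ⟨h3, h4⟩
    simp only [Set.mem_ofPred_eq, Pi.mul_apply, Complex.mul_re, Complex.mul_im]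
    exact ⟨sub_mem (mul_mem h1 h3) (mul_mem h2 h4), add_mem (mul_mem h1 h4) (mul_mem h2 h3)⟩
  add_mem' := by
    rintro f g ⟨h1, h2⟩ ⟨h3, h4⟩
    exact ⟨add_mem h1 h3, add_mem h2 h4⟩
  algebraMap_mem' := fun c => ⟨𝒜.algebraMap_mem c.re, 𝒜.algebraMap_mem c.im⟩

section complexify

variable {Y : Type*} {𝒜 : Subalgebra ℝ (Y → ℝ)}

/-- Multiplying `Q f = P` by the conjugate of `Q` gives `|Q|² f = Re (conj Q * P)`, because `f` is
real. -/
theorem mem_localFractions_of_fracAt {f : Y → ℝ}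
    (h : ∀ y₀, (fun y => (f y : ℂ)) ∈ fracAt (complexify 𝒜) Set.univ y₀) :
    f ∈ localFractions 𝒜 := by
  intro y₀
  obtain ⟨P, hP, Q, hQ, h0, H⟩ := h y₀
  refine ⟨fun y => (Q y).re * (P y).re + (Q y).im * (P y).im,
    add_mem (mul_mem hQ.1 hP.1) (mul_mem hQ.2 hP.2),
    fun y => (Q y).re * (Q y).re + (Q y).im * (Q y).im,
    add_mem (mul_mem hQ.1 hQ.1) (mul_mem hQ.2 hQ.2), ?_, fun y => ?_⟩
  · exact fun h => h0 (Complex.normSq_eq_zero.1 h)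
  · simp [← H y trivial]
    ring

end complexify

section localFractions

variable {Y Z : Type*}

theorem le_localFractions {𝒜 : Subalgebra ℝ (Y → ℝ)} : 𝒜 ≤ localFractions 𝒜 :=
  fun f hf _ => ⟨f, hf, 1, 𝒜.one_mem, by simp, fun y => by simp⟩

theorem comp_mem_localFractions {𝒜 : Subalgebra ℝ (Z → ℝ)} {ℬ : Subalgebra ℝ (Y → ℝ)} {φ : Y → Z}
    (h : ∀ f ∈ 𝒜, f ∘ φ ∈ localFractions ℬ) {f : Z → ℝ} (hf : f ∈ localFractions 𝒜) :
    f ∘ φ ∈ localFractions ℬ := by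
  intro y
  obtain ⟨P, hP, Q, hQ, h0, H⟩ := hf (φ y)
  obtain ⟨P₁, hP₁, Q₁, hQ₁, h₁, H₁⟩ := h Q hQ y
  obtain ⟨P₂, hP₂, Q₂, hQ₂, h₂, H₂⟩ := h P hP y
  refine ⟨Q₁ * P₂, mul_mem hQ₁ hP₂, Q₂ * P₁, mul_mem hQ₂ hP₁, ?_, fun z => ?_⟩
  · rw [Pi.mul_apply, ← H₁]
    exact mul_ne_zero h₂ (mul_ne_zero h₁ h0)
  · simp only [Pi.mul_apply, ← H₁, ← H₂, Function.comp_apply, ← H]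
    ring

theorem comp_mem_of_adjoin {G : Set (Z → ℝ)} {ℬ : Subalgebra ℝ (Y → ℝ)} {φ : Y → Z}
    (h : ∀ f ∈ G, f ∘ φ ∈ ℬ) {f : Z → ℝ} (hf : f ∈ Algebra.adjoin ℝ G) : f ∘ φ ∈ ℬ := by
  have : Algebra.adjoin ℝ G ≤ ℬ.comap (pullback φ) := Algebra.adjoin_le h
  exact this hf

end localFractions

/-! ### Multisymmetric functions are polynomials in power sums -/

/-- A Newton type recursion. Dropping the condition that index `0` avoids the others splits off the
factor `∑ i, ψ 0 i`; the error terms are those where it collides with index `k`, and there `ψ 0`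
merges into the factor of `k`. The set `I` need not contain `1`, which matters for the span of
alternating forms. -/
theorem sum_embedding_prod_mem {R ι : Type*} [CommRing R] [Algebra ℂ R] (A : Subalgebra ℂ R)
    [Fintype ι] [DecidableEq ι] (I : Set (ι → R)) (hmul : ∀ f ∈ I, ∀ g ∈ I, f * g ∈ I)
    (hsum : ∀ f ∈ I, ∑ i, f i ∈ A) (m : ℕ) (ψ : Fin m → ι → R) (hψ : ∀ l, ψ l ∈ I) :
    ∑ f : Fin m ↪ ι, ∏ l, ψ l (f l) ∈ A := by
  induction m with
  | zero => simp
  | succ m ih =>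
    have key : ∑ f : Fin (m + 1) ↪ ι, ∏ l, ψ l (f l) =
        (∑ i, ψ 0 i) * (∑ f : Fin m ↪ ι, ∏ l, ψ l.succ (f l)) -
        ∑ k, ∑ f : Fin m ↪ ι, ∏ l, (if l = k then ψ l.succ * ψ 0 else ψ l.succ) (f l) := by
      rw [← (Equiv.embeddingFinSucc m ι).symm.sum_comp, Fintype.sum_sigma, Finset.mul_sum,
        Finset.sum_comm, ← Finset.sum_sub_distrib]
      refine Finset.sum_congr rfl fun f _ => ?_
      have h1 : ∀ k, ∏ l, (if l = k then ψ l.succ * ψ 0 else ψ l.succ) (f l) =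
          ψ 0 (f k) * ∏ l, ψ l.succ (f l) := by
        intro k
        have : ∀ l, (if l = k then ψ l.succ * ψ 0 else ψ l.succ) (f l) =
            ψ l.succ (f l) * (if l = k then ψ 0 (f l) else 1) := by
          intro l
          split_ifs <;> simp
        simp_rw [this]
        rw [Finset.prod_mul_distrib, Finset.prod_ite_eq' Finset.univ k (fun l => ψ 0 (f l))]
        simp [mul_comm]
      simp_rw [h1]
      rw [← Finset.sum_mul, ← sub_mul]
      have h2 : ∑ i, ψ 0 i - ∑ k, ψ 0 (f k) = ∑ i : {i // i ∉ Set.range f}, ψ 0 i := by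
        rw [sub_eq_iff_eq_add]
        have h3 : ∑ k, ψ 0 (f k) = ∑ i : {i // i ∈ Set.range f}, ψ 0 i :=
          Fintype.sum_equiv (Equiv.ofInjective f f.injective) _ _ (fun k => by simp)
        have h4 := Fintype.sum_subtype_add_sum_subtype (fun i => i ∈ Set.range f) (ψ 0)
        rw [h3, ← h4]
        rw [add_comm]
        congr!
      rw [h2, Finset.sum_mul]
      refine Finset.sum_congr rfl fun i _ => ?_
      rw [Fin.prod_univ_succ]
      simp [Equiv.coe_embeddingFinSucc_symm]
    rw [key]
    refine sub_mem (mul_mem (hsum _ (hψ 0)) (ih _ fun l => hψ _)) (sum_mem fun k _ => ih _ fun l => ?_)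
    split_ifs
    · exact hmul _ (hψ _) _ (hψ _)
    · exact hψ _

theorem sum_perm_prod_mem {R : Type*} [CommRing R] [Algebra ℂ R] (A : Subalgebra ℂ R) {m : ℕ}
    (I : Set (Fin m → R)) (hmul : ∀ f ∈ I, ∀ g ∈ I, f * g ∈ I)
    (hsum : ∀ f ∈ I, ∑ i, f i ∈ A) (ψ : Fin m → Fin m → R) (hψ : ∀ l, ψ l ∈ I) :
    ∑ σ : Equiv.Perm (Fin m), ∏ l, ψ l (σ l) ∈ A := by
  have h := sum_embedding_prod_mem A I hmul hsum m ψ hψ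
  have hb : Function.Bijective fun σ : Equiv.Perm (Fin m) => σ.toEmbedding := by
    constructor
    · intro σ τ h
      ext x
      exact congrArg Fin.val (DFunLike.congr_fun h x)
    · intro f
      exact ⟨Equiv.ofBijective f (Finite.injective_iff_bijective.1 f.injective), by ext; rfl⟩
  rwa [← Fintype.sum_bijective _ hb (fun σ => ∏ l, ψ l (σ l)) _ (fun σ => rfl)] at h

/-- Summing a product of functions of the single points over a product of symmetric groups. -/
theorem sum_pi_perm_prod {R ι : Type*} [CommSemiring R] [Fintype ι] [DecidableEq ι] (a : ι → ℕ)
    (M : ∀ i, Fin (a i) → Fin (a i) → R) :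
    ∑ g : ∀ i, Equiv.Perm (Fin (a i)), ∏ i, ∏ l, M i l (g i l) =
      ∏ i, ∑ σ : Equiv.Perm (Fin (a i)), ∏ l, M i l (σ l) := by
  rw [Finset.prod_univ_sum, Fintype.piFinset_univ]

end TwistedHopf

namespace TwistedHopf

open Matrix

/-! ### Matrices and characters of unitary representations -/

variable {n : ℕ}

/-- The matrix of `ρ γ`. -/
def Rep.mat {r : ℕ} (ρ : Rep n r) : LinkGroup n →* Matrix (Fin r) (Fin r) ℂ :=
  (Matrix.unitaryGroup (Fin r) ℂ).subtype.comp ρ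

theorem Rep.mat_apply {r : ℕ} (ρ : Rep n r) (γ : LinkGroup n) :
    ρ.mat γ = (ρ γ : Matrix (Fin r) (Fin r) ℂ) := rfl

theorem Rep.mat_inv {r : ℕ} (ρ : Rep n r) (γ : LinkGroup n) : ρ.mat γ⁻¹ = (ρ.mat γ)ᴴ := by
  rw [Rep.mat_apply, map_inv]
  rfl

theorem Rep.ext_mat {r : ℕ} {ρ σ : Rep n r} (h : ∀ γ, ρ.mat γ = σ.mat γ) : ρ = σ :=
  MonoidHom.ext fun γ => Subtype.ext (h γ)

/-- The matrices of `ρ` span the matrix algebra. -/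
def Rep.Spans {r : ℕ} (ρ : Rep n r) : Prop := Submodule.span ℂ (Set.range ρ.mat) = ⊤

theorem Rep.toRepresentation_apply {r : ℕ} (ρ : Rep n r) (γ : LinkGroup n) :
    ρ.toRepresentation γ = Matrix.toLin' (ρ.mat γ) := rfl

theorem Rep.IsIrreducible.pos {r : ℕ} {ρ : Rep n r} (h : ρ.IsIrreducible) : 0 < r := by
  rcases Nat.eq_zero_or_pos r with rfl | hr
  · exfalso
    have : IsSimpleOrder (Subrepresentation ρ.toRepresentation) := h
    obtain ⟨x, y, hxy⟩ := exists_pair_ne (Subrepresentation ρ.toRepresentation)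
    exact hxy (Subrepresentation.toSubmodule_injective (Subsingleton.elim _ _))
  · exact hr

/-- Burnside's theorem. -/
theorem Rep.IsIrreducible.spans {r : ℕ} {ρ : Rep n r} (h : ρ.IsIrreducible) : ρ.Spans := by
  have : IsSimpleModule (MonoidAlgebra ℂ (LinkGroup n)) ρ.toRepresentation.asModule :=
    (Representation.irreducible_iff_isSimpleModule_asModule _).1 h
  rw [Rep.Spans, eq_top_iff]
  rintro X -
  let A := MonoidAlgebra ℂ (LinkGroup n)
  let M := ρ.toRepresentation.asModule
  let E : M ≃ₗ[ℂ] (Fin r → ℂ) := ρ.toRepresentation.asModuleEquiv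
  let F : M →ₗ[ℂ] M := E.symm.toLinearMap ∘ₗ Matrix.toLin' X ∘ₗ E.toLinearMap
  -- By Schur's lemma the module endomorphisms are scalars, so every linear map commutes with them,
  -- and the density theorem realises `X` on the finite standard basis.
  have hs := IsSimpleModule.algebraMap_end_bijective_of_isAlgClosed (A := A) (V := M) ℂ
  let f : Module.End (Module.End A M) M :=
    { toFun := F
      map_add' := F.map_add
      map_smul' := by
        intro c m
        obtain ⟨t, rfl⟩ := hs.2 c
        simp only [RingHom.id_apply, Module.End.smul_def, Module.algebraMap_end_apply, map_smul] }
  classical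
  obtain ⟨x, hx⟩ := jacobson_density f (Finset.univ.image fun i : Fin r => E.symm (Pi.single i 1))
  have hX : Matrix.toLin' X = ρ.toRepresentation.asAlgebraHom x := by
    refine LinearMap.pi_ext' fun i => LinearMap.ext_ring ?_
    have h1 := hx _ (Finset.mem_image_of_mem _ (Finset.mem_univ i))
    have h2 := congrArg E h1
    rw [show E (x • E.symm (Pi.single i 1)) = _ from
      Representation.asModuleEquiv_map_smul ρ.toRepresentation x _] at h2
    simp only [f, F, LinearMap.coe_mk, AddHom.coe_mk, LinearMap.comp_apply,
      LinearEquiv.coe_coe, LinearEquiv.apply_symm_apply] at h2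
    simp only [LinearMap.comp_apply, LinearMap.coe_single]
    rw [h2, show ρ.toRepresentation.asModuleEquiv (E.symm (Pi.single i 1)) = Pi.single i 1 from
      E.apply_symm_apply _]
  have key : ∀ x : MonoidAlgebra ℂ (LinkGroup n), LinearMap.toMatrix'
      (ρ.toRepresentation.asAlgebraHom x) ∈ Submodule.span ℂ (Set.range ρ.mat) := by
    intro x
    induction x using MonoidAlgebra.induction_linear with
    | zero => simp
    | add x y hx hy => rw [map_add, map_add]; exact add_mem hx hy
    | single γ t =>
      rw [Representation.asAlgebraHom_single, map_smul, Rep.toRepresentation_apply,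
        LinearMap.toMatrix'_toLin']
      exact Submodule.smul_mem _ _ (Submodule.subset_span ⟨γ, rfl⟩)
  have h3 := key x
  rwa [← hX, LinearMap.toMatrix'_toLin'] at h3

/-- An invariant subspace is stable under all matrices, and a matrix of rank one carries a given
nonzero vector to any other vector. -/
theorem Rep.Spans.isIrreducible {r : ℕ} (hr : 0 < r) {ρ : Rep n r} (h : ρ.Spans) :
    ρ.IsIrreducible := by
  have : Nonempty (Fin r) := ⟨⟨0, hr⟩⟩
  have hne : (⊥ : Subrepresentation ρ.toRepresentation) ≠ ⊤ := by
    intro hbt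
    have h1 := congrArg Subrepresentation.toSubmodule hbt
    exact bot_ne_top (α := Submodule ℂ (Fin r → ℂ)) h1
  have : Nontrivial (Subrepresentation ρ.toRepresentation) := ⟨⟨_, _, hne⟩⟩
  refine IsSimpleOrder.mk fun W => ?_
  by_cases hW : W.toSubmodule = ⊥
  · exact Or.inl (Subrepresentation.toSubmodule_injective hW)
  · refine Or.inr (Subrepresentation.toSubmodule_injective ?_)
    obtain ⟨v, hv, hv0⟩ := Submodule.exists_mem_ne_zero_of_ne_bot hW
    have hmul : ∀ X : Matrix (Fin r) (Fin r) ℂ, X *ᵥ v ∈ W.toSubmodule := by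
      intro X
      have hX : X ∈ Submodule.span ℂ (Set.range ρ.mat) := by
        rw [Rep.Spans] at h
        rw [h]; trivial
      induction hX using Submodule.span_induction with
      | mem X hX =>
        obtain ⟨γ, rfl⟩ := hX
        exact W.apply_mem_toSubmodule γ hv
      | zero => simp
      | add X Y _ _ hX hY => rw [Matrix.add_mulVec]; exact add_mem hX hY
      | smul c X _ hX => rw [Matrix.smul_mulVec]; exact W.toSubmodule.smul_mem _ hX
    obtain ⟨j, hj⟩ := Function.ne_iff.1 hv0
    change W.toSubmodule = (⊤ : Submodule ℂ (Fin r → ℂ))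
    rw [eq_top_iff]
    rintro w -
    have h1 := hmul (Matrix.vecMulVec w (Pi.single j (v j)⁻¹))
    rw [Matrix.vecMulVec_mulVec] at h1
    simpa [inv_mul_cancel₀ hj] using h1

/-- The points of all representation spaces. -/
abbrev RepPt (n : ℕ) : Type := Σ m, Rep n m

/-- The character, as a function of the representation. -/
def chi (γ : LinkGroup n) (z : RepPt n) : ℂ := (z.2.mat γ).trace

theorem star_chi (γ : LinkGroup n) : star (chi γ) = chi γ⁻¹ := by
  ext z
  simp [chi, Rep.mat_inv, Matrix.trace_conjTranspose]

end TwistedHopf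

namespace TwistedHopf

open Matrix

/-! ### Alternating forms in the matrices of a representation -/

/-- In top degree an alternating form is a multiple of the determinant. By Cramer's rule the sum
becomes `tr (adj x * T * x) = tr T * det x`. -/
theorem sum_update_eq_trace_mul {ι M : Type*} [Fintype ι] [DecidableEq ι] [AddCommGroup M]
    [Module ℂ M] (b : Module.Basis ι ℂ M) (f : M [⋀^ι]→ₗ[ℂ] ℂ) (T : M →ₗ[ℂ] M) (x : ι → M) :
    ∑ s, f (Function.update x s (T (x s))) = LinearMap.trace ℂ M T * f x := by
  rw [f.eq_smul_basis_det b]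
  simp only [AlternatingMap.smul_apply, smul_eq_mul, ← Finset.mul_sum, Module.Basis.det_apply]
  have h : ∀ s, (b.toMatrix (Function.update x s (T (x s)))).det =
      ((b.toMatrix x).adjugate * (LinearMap.toMatrix b b T * b.toMatrix x)) s s := by
    intro s
    have h1 : (LinearMap.toMatrix b b T * b.toMatrix x).col s = b.repr (T (x s)) := by
      rw [← LinearMap.toMatrix_mulVec_repr b b T (x s)]
      rfl
    rw [Module.Basis.toMatrix_update, ← cramer_apply, ← h1, cramer_eq_adjugate_mulVec]
    rfl
  simp_rw [h]
  rw [show ∑ s, ((b.toMatrix x).adjugate * (LinearMap.toMatrix b b T * b.toMatrix x)) s s =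
    ((b.toMatrix x).adjugate * (LinearMap.toMatrix b b T * b.toMatrix x)).trace from rfl,
    Matrix.trace_mul_comm, mul_assoc, mul_adjugate, LinearMap.trace_eq_matrix_trace ℂ b]
  simp
  ring

theorem trace_mulLeft {m : ℕ} (a : Matrix (Fin m) (Fin m) ℂ) :
    LinearMap.trace ℂ _ (LinearMap.mulLeft ℂ a) = m * a.trace := by
  rw [LinearMap.trace_eq_matrix_trace ℂ (Matrix.stdBasis ℂ (Fin m) (Fin m)), Matrix.trace]
  have h : ∀ p : Fin m × Fin m, (LinearMap.toMatrix (Matrix.stdBasis ℂ (Fin m) (Fin m))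
      (Matrix.stdBasis ℂ (Fin m) (Fin m)) (LinearMap.mulLeft ℂ a)).diag p = a p.1 p.1 := by
    rintro ⟨i, j⟩
    rw [Matrix.diag_apply, LinearMap.toMatrix_apply, Matrix.stdBasis_eq_single]
    change (a * Matrix.single i j (1 : ℂ) : Matrix (Fin m) (Fin m) ℂ) i j = _
    simp
  simp_rw [h]
  rw [Fintype.sum_prod_type]
  simp [Matrix.trace, Finset.mul_sum]

theorem multilinear_eq_zero_of_span {ι M : Type*} [Finite ι] [AddCommGroup M] [Module ℂ M]
    (f : MultilinearMap ℂ (fun _ : ι => M) ℂ) {S : Set M} (hS : Submodule.span ℂ S = ⊤)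
    (h : ∀ x : ι → M, (∀ i, x i ∈ S) → f x = 0) : f = 0 := by
  refine Module.Basis.ext_multilinear (fun _ => Module.Basis.ofSpan hS.ge) fun v => ?_
  rw [h, _root_.zero_apply]
  exact fun i => Module.Basis.ofSpan_subset hS.ge ⟨v i, rfl⟩

/-- The multilinear form `(x_s) ↦ tr (u * x_0 * y_0 * x_1 * y_1 * ⋯)`. -/
def wordForm {m N : ℕ} (u : Matrix (Fin m) (Fin m) ℂ) (y : Fin N → Matrix (Fin m) (Fin m) ℂ) :
    MultilinearMap ℂ (fun _ : Fin N => Matrix (Fin m) (Fin m) ℂ) ℂ :=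
  (Matrix.traceLinearMap (Fin m) ℂ ℂ ∘ₗ LinearMap.mulLeft ℂ u).compMultilinearMap
    ((MultilinearMap.mkPiAlgebraFin ℂ N (Matrix (Fin m) (Fin m) ℂ)).compLinearMap
      fun s => LinearMap.mulRight ℂ (y s))

theorem wordForm_apply {m N : ℕ} (u : Matrix (Fin m) (Fin m) ℂ)
    (x y : Fin N → Matrix (Fin m) (Fin m) ℂ) :
    wordForm u y x = (u * (List.ofFn fun s => x s * y s).prod).trace := by
  simp [wordForm]

/-- The alternating form obtained from `wordForm`. -/
def capelliForm {m N : ℕ} (u : Matrix (Fin m) (Fin m) ℂ) (y : Fin N → Matrix (Fin m) (Fin m) ℂ) :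
    Matrix (Fin m) (Fin m) ℂ [⋀^Fin N]→ₗ[ℂ] ℂ :=
  MultilinearMap.alternatization (wordForm u y)

theorem capelliForm_apply {m N : ℕ} (u : Matrix (Fin m) (Fin m) ℂ)
    (x y : Fin N → Matrix (Fin m) (Fin m) ℂ) :
    capelliForm u y x = ∑ σ : Equiv.Perm (Fin N), ((Equiv.Perm.sign σ : ℤ) : ℂ) *
      (u * (List.ofFn fun s => x (σ s) * y s).prod).trace := by
  rw [capelliForm, MultilinearMap.alternatization_apply]
  refine Finset.sum_congr rfl fun σ _ => ?_
  rw [MultilinearMap.domDomCongr_apply, wordForm_apply, Units.smul_def, zsmul_eq_mul]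

/-- The interlaced matrix units pick one entry from each `X s` and chain together, so the product
collapses to a single matrix unit. -/
theorem single_mul_prod_ofFn {m : ℕ} (a : Fin m) (i j : ℕ → Fin m)
    (X : ℕ → Matrix (Fin m) (Fin m) ℂ) (N : ℕ) :
    single a (i 0) 1 * (List.ofFn fun s : Fin N => X s * single (j s) (i (s + 1)) 1).prod =
      (∏ s ∈ Finset.range N, X s (i s) (j s)) • single a (i N) 1 := by
  induction N with
  | zero => simp
  | succ N ih =>
    rw [List.ofFn_succ', List.concat_eq_append, List.prod_append, ← mul_assoc]
    simp only [Fin.val_castSucc, Fin.val_last, List.prod_singleton]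
    rw [ih, Finset.prod_range_succ, smul_mul_assoc, ← mul_assoc, mul_smul]
    congr 1
    ext p q
    rw [Matrix.mul_apply]
    simp only [Matrix.smul_apply, Matrix.single_apply]
    by_cases hp : a = p
    · subst hp
      by_cases hq : i (N + 1) = q
      · subst hq
        simp
      · simp [hq]
    · refine Eq.trans (Finset.sum_eq_zero fun k _ => ?_) ?_
      · rw [Matrix.single_mul_apply_of_ne _ _ _ _ _ (Ne.symm hp), zero_mul]
      · simp [hp]

/-- Take for `x` all matrix units and for `y` the units connecting each to the next. A permuted word
requires the entry of `x (σ s)` at the position of `x s`, so only the identity permutation survives.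
-/
theorem exists_capelliForm_ne_zero {m : ℕ} (hm : 0 < m) :
    ∃ u : Matrix (Fin m) (Fin m) ℂ, ∃ x y : Fin (m * m) → Matrix (Fin m) (Fin m) ℂ,
      capelliForm u y x ≠ 0 := by
  -- The default value serves only as `p (m * m)`, the index through which the last connecting unit
  -- and `u` close the word up to a nonzero trace.
  let p : ℕ → Fin m × Fin m := fun s =>
    if h : s < m * m then finProdFinEquiv.symm ⟨s, h⟩ else (⟨0, hm⟩, ⟨0, hm⟩)
  have hp : ∀ s : Fin (m * m), p s = finProdFinEquiv.symm s := fun s => by simp [p]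
  let E : ℕ → Matrix (Fin m) (Fin m) ℂ := fun s => single (p s).1 (p s).2 1
  refine ⟨single (p (m * m)).1 (p 0).1 1, fun s => E s,
    fun s => single (p s).2 (p (s + 1)).1 1, ?_⟩
  rw [capelliForm_apply, Finset.sum_eq_single 1]
  · have h := single_mul_prod_ofFn (p (m * m)).1 (fun s => (p s).1) (fun s => (p s).2) E (m * m)
    simp only [Equiv.Perm.sign_one, Equiv.Perm.one_apply]
    rw [h]
    simp [E]
  · intro σ _ hσ
    let X : ℕ → Matrix (Fin m) (Fin m) ℂ := fun s => if h : s < m * m then E (σ ⟨s, h⟩) else 0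
    have h := single_mul_prod_ofFn (p (m * m)).1 (fun s => (p s).1) (fun s => (p s).2) X (m * m)
    have hX : ∀ s : Fin (m * m), X s = E (σ s) := fun s => by simp [X]
    simp_rw [hX] at h
    rw [h]
    obtain ⟨s, hs⟩ : ∃ s, σ s ≠ s := by
      by_contra! hc
      exact hσ (Equiv.ext hc)
    rw [Finset.prod_eq_zero (Finset.mem_range.2 s.2)]
    · simp
    · rw [hX]
      simp only [E]
      rw [Matrix.single_apply, if_neg]
      rintro ⟨h1, h2⟩
      have : p (σ s) = p s := Prod.ext h1 h2
      rw [hp, hp] at this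
      exact hs (finProdFinEquiv.symm.injective this)
  · simp

variable {n : ℕ}

/-- The alternating form evaluated on the matrices of a representation. -/
def capelli {N : ℕ} (u : LinkGroup n) (x y : Fin N → LinkGroup n) (z : RepPt n) : ℂ :=
  capelliForm (z.2.mat u) (fun s => z.2.mat (y s)) fun s => z.2.mat (x s)

/-- Linearity in the characters is the point: summed over the members of a tuple, the form becomes a
combination of total characters. -/
theorem capelli_eq_sum {N : ℕ} (u : LinkGroup n) (x y : Fin N → LinkGroup n) :
    capelli u x y = ∑ σ : Equiv.Perm (Fin N), ((Equiv.Perm.sign σ : ℤ) : ℂ) •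
      chi (u * (List.ofFn fun s => x (σ s) * y s).prod) := by
  ext z
  rw [capelli, capelliForm_apply, Finset.sum_apply]
  refine Finset.sum_congr rfl fun σ _ => ?_
  rw [Pi.smul_apply, chi, map_mul, map_list_prod, List.map_ofFn, smul_eq_mul]
  congr 5
  ext s
  simp

theorem capelli_eq_zero {N : ℕ} (u : LinkGroup n) (x y : Fin N → LinkGroup n) {m : ℕ}
    (hm : m * m < N) (ρ : Rep n m) : capelli u x y ⟨m, ρ⟩ = 0 := by
  refine AlternatingMap.map_linearDependent _ _ fun h => ?_
  have := h.fintype_card_le_finrank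
  simp [Module.finrank_matrix] at this
  omega

/-- The form has top degree on the matrix algebra, so `sum_update_eq_trace_mul` applies to left
multiplication by the matrix of `a`, an operator of trace `m * chi a`. -/
theorem chi_mul_capelli {m : ℕ} (a u : LinkGroup n) (x y : Fin (m * m) → LinkGroup n)
    (ρ : Rep n m) : (m : ℂ) * (chi a ⟨m, ρ⟩ * capelli u x y ⟨m, ρ⟩) =
      ∑ s, capelli u (Function.update x s (a * x s)) y ⟨m, ρ⟩ := by
  have h := sum_update_eq_trace_mul ((Matrix.stdBasis ℂ (Fin m) (Fin m)).reindex finProdFinEquiv)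
    (capelliForm (ρ.mat u) fun s => ρ.mat (y s)) (LinearMap.mulLeft ℂ (ρ.mat a))
    (fun s => ρ.mat (x s))
  rw [trace_mulLeft] at h
  rw [← mul_assoc, chi, capelli]
  refine h.symm.trans (Finset.sum_congr rfl fun s _ => ?_)
  rw [capelli]
  congr 1
  ext1 t
  by_cases hts : t = s
  · subst hts; simp
  · simp [hts]

/-- If all values on group elements vanished, multilinearity in `u`, then `x`, then `y` would spread
this over the whole matrix algebra, against `exists_capelliForm_ne_zero`. -/
theorem exists_capelli_ne_zero {m : ℕ} (hm : 0 < m) {ρ : Rep n m} (h : ρ.Spans) :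
    ∃ (u : LinkGroup n) (x y : Fin (m * m) → LinkGroup n), capelli u x y ⟨m, ρ⟩ ≠ 0 := by
  by_contra! hc
  obtain ⟨u, x, y, hne⟩ := exists_capelliForm_ne_zero hm
  have hmem : ∀ X, X ∈ Submodule.span ℂ (Set.range ρ.mat) := fun X => by
    rw [Rep.Spans] at h
    rw [h]; trivial
  have h1 : ∀ (u : Matrix (Fin m) (Fin m) ℂ) (x y : Fin (m * m) → LinkGroup n),
      capelliForm u (fun s => ρ.mat (y s)) (fun s => ρ.mat (x s)) = 0 := by
    intro u x y
    have hu := hmem u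
    induction hu using Submodule.span_induction with
    | mem u hu =>
      obtain ⟨γ, rfl⟩ := hu
      exact hc γ x y
    | zero => simp [capelliForm_apply]
    | add u v _ _ hu hv =>
      rw [capelliForm_apply] at hu hv ⊢
      simp only [Matrix.add_mul, Matrix.trace_add, mul_add, Finset.sum_add_distrib, hu, hv,
        add_zero]
    | smul c u _ hu =>
      rw [capelliForm_apply] at hu ⊢
      simp only [Matrix.smul_mul, Matrix.trace_smul, smul_eq_mul, mul_left_comm _ c,
        ← Finset.mul_sum, hu, mul_zero]
  have h2 : ∀ (u : Matrix (Fin m) (Fin m) ℂ) (x : Fin (m * m) → Matrix (Fin m) (Fin m) ℂ)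
      (y : Fin (m * m) → LinkGroup n), capelliForm u (fun s => ρ.mat (y s)) x = 0 := by
    intro u x y
    have := multilinear_eq_zero_of_span
      (capelliForm u (fun s => ρ.mat (y s))).toMultilinearMap h (by
        intro x hx
        choose g hg using hx
        obtain rfl : (fun s => ρ.mat (g s)) = x := funext hg
        exact h1 u g y)
    exact DFunLike.congr_fun this x
  let G : MultilinearMap ℂ (fun _ : Fin (m * m) => Matrix (Fin m) (Fin m) ℂ) ℂ :=
    ∑ σ : Equiv.Perm (Fin (m * m)), ((Equiv.Perm.sign σ : ℤ) : ℂ) •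
      (Matrix.traceLinearMap (Fin m) ℂ ℂ ∘ₗ LinearMap.mulLeft ℂ u).compMultilinearMap
        ((MultilinearMap.mkPiAlgebraFin ℂ (m * m) (Matrix (Fin m) (Fin m) ℂ)).compLinearMap
          fun s => LinearMap.mulLeft ℂ (x (σ s)))
  have hG : ∀ y, G y = capelliForm u y x := by
    intro y
    rw [capelliForm_apply]
    simp [G]
  have h3 := multilinear_eq_zero_of_span G h (by
    intro y hy
    choose g hg using hy
    obtain rfl : (fun s => ρ.mat (g s)) = y := funext hg
    rw [hG]
    exact h2 u x g)
  exact hne (by rw [← hG, h3]; rfl)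

/-- An alternating form vanishes on dependent arguments, so the `m * m` matrices of the `x s` form a
basis. -/
theorem spans_of_capelli_ne_zero {m : ℕ} {ρ : Rep n m} {u : LinkGroup n}
    {x y : Fin (m * m) → LinkGroup n} (h : capelli u x y ⟨m, ρ⟩ ≠ 0) : ρ.Spans := by
  have hli : LinearIndependent ℂ fun s => ρ.mat (x s) := by
    by_contra hc
    exact h (AlternatingMap.map_linearDependent _ _ hc)
  have hspan := hli.span_eq_top_of_card_eq_finrank' (by simp [Module.finrank_matrix])
  rw [Rep.Spans, eq_top_iff, ← hspan]
  refine Submodule.span_mono ?_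
  rintro _ ⟨s, rfl⟩
  exact ⟨_, rfl⟩

end TwistedHopf

namespace TwistedHopf

open Matrix
open scoped ComplexOrder

variable {n : ℕ}

/-! ### The group algebra -/

/-- The extension of a representation to the group algebra. -/
noncomputable def Rep.alg {m : ℕ} (ρ : Rep n m) :
    MonoidAlgebra ℂ (LinkGroup n) →ₐ[ℂ] Matrix (Fin m) (Fin m) ℂ :=
  MonoidAlgebra.lift ℂ _ _ ρ.mat

theorem Rep.alg_single {m : ℕ} (ρ : Rep n m) (γ : LinkGroup n) (t : ℂ) :
    ρ.alg (MonoidAlgebra.single γ t) = t • ρ.mat γ := by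
  rw [Rep.alg, MonoidAlgebra.lift_single]

theorem Rep.Spans.alg_surjective {m : ℕ} {ρ : Rep n m} (h : ρ.Spans) :
    Function.Surjective ρ.alg := by
  intro X
  have hX : X ∈ Submodule.span ℂ (Set.range ρ.mat) := by
    rw [Rep.Spans] at h
    rw [h]; trivial
  have hle : Submodule.span ℂ (Set.range ρ.mat) ≤ LinearMap.range ρ.alg.toLinearMap := by
    refine Submodule.span_le.2 ?_
    rintro _ ⟨γ, rfl⟩
    exact ⟨MonoidAlgebra.single γ 1, by simp [Rep.alg_single]⟩
  exact hle hX

theorem exists_alg_eq_conjTranspose (x : MonoidAlgebra ℂ (LinkGroup n)) :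
    ∃ x' : MonoidAlgebra ℂ (LinkGroup n), ∀ (m : ℕ) (ρ : Rep n m), ρ.alg x' = (ρ.alg x)ᴴ := by
  induction x using MonoidAlgebra.induction_linear with
  | zero => exact ⟨0, by simp⟩
  | add x y hx hy =>
    obtain ⟨x', hx'⟩ := hx
    obtain ⟨y', hy'⟩ := hy
    exact ⟨x' + y', by simp [hx', hy']⟩
  | single γ t =>
    exact ⟨MonoidAlgebra.single γ⁻¹ (star t), by simp [Rep.alg_single, Rep.mat_inv]⟩

theorem trace_alg_mem (x : MonoidAlgebra ℂ (LinkGroup n)) :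
    (fun z : RepPt n => (z.2.alg x).trace) ∈ Submodule.span ℂ (Set.range (chi (n := n))) := by
  induction x using MonoidAlgebra.induction_linear with
  | zero =>
    simp only [map_zero, Matrix.trace_zero]
    exact Submodule.zero_mem (Submodule.span ℂ (Set.range (chi (n := n))))
  | add x y hx hy =>
    simp only [map_add, Matrix.trace_add]
    exact Submodule.add_mem _ hx hy
  | single γ t =>
    have h : (fun z : RepPt n => (z.2.alg (MonoidAlgebra.single γ t)).trace) = t • chi γ := by
      ext z
      simp [Rep.alg_single, chi]
    rw [h]
    exact Submodule.smul_mem _ _ (Submodule.subset_span ⟨γ, rfl⟩)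

theorem trace_alg_eq {m m' : ℕ} {ρ : Rep n m} {σ : Rep n m'}
    (h : ∀ γ, chi γ ⟨m, ρ⟩ = chi γ ⟨m', σ⟩) (x : MonoidAlgebra ℂ (LinkGroup n)) :
    (ρ.alg x).trace = (σ.alg x).trace := by
  have := trace_alg_mem x
  exact Submodule.span_induction (p := fun f _ => f ⟨m, ρ⟩ = f ⟨m', σ⟩)
    (by rintro _ ⟨γ, rfl⟩; exact h γ) rfl (fun f g _ _ hf hg => by simp [hf, hg])
    (fun c f _ hf => by simp [hf]) this

/-! ### Irreducible unitary representations are determined by their characters -/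

theorem exists_vector_of_projection {m : ℕ} {P : Matrix (Fin m) (Fin m) ℂ} (h1 : Pᴴ = P)
    (h2 : P * P = P) (h3 : P.trace = 1) : ∃ V : Matrix (Fin m) Unit ℂ, V * Vᴴ = P := by
  have hP : P ≠ 0 := by
    rintro rfl
    simp at h3
  obtain ⟨k, hk⟩ : ∃ k, P.col k ≠ 0 := by
    by_contra! hc
    exact hP (by ext i j; exact congrFun (hc j) i)
  let w : Fin m → ℂ := P.col k
  let t : ℝ := ∑ i, Complex.normSq (w i)
  have ht : 0 < t := by
    obtain ⟨i, hi⟩ := Function.ne_iff.1 hk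
    exact Finset.sum_pos' (fun i _ => Complex.normSq_nonneg _)
      ⟨i, Finset.mem_univ _, Complex.normSq_pos.2 hi⟩
  let W : Matrix (Fin m) Unit ℂ := Matrix.of fun i _ => w i
  have hPW : P * W = W := by
    ext i j
    have := congrFun (congrFun h2 i) k
    rw [Matrix.mul_apply] at this ⊢
    exact this
  have hWW : Wᴴ * W = (t : ℂ) • (1 : Matrix Unit Unit ℂ) := by
    ext i j
    rw [Matrix.mul_apply]
    simp only [W, t, Matrix.conjTranspose_apply, Matrix.of_apply, Matrix.smul_apply, smul_eq_mul]
    rw [Subsingleton.elim i j, Matrix.one_apply_eq, mul_one, Complex.ofReal_sum]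
    exact Finset.sum_congr rfl fun x _ => by rw [Complex.normSq_eq_conj_mul_self]; rfl
  have ht' : (t : ℂ) ≠ 0 := Complex.ofReal_ne_zero.2 ht.ne'
  have hsq : ((Real.sqrt t : ℝ) : ℂ) * ((Real.sqrt t : ℝ) : ℂ) = t := by
    rw [← Complex.ofReal_mul, Real.mul_self_sqrt ht.le]
  refine ⟨((Real.sqrt t : ℝ) : ℂ)⁻¹ • W, ?_⟩
  have hV : (((Real.sqrt t : ℝ) : ℂ)⁻¹ • W) * (((Real.sqrt t : ℝ) : ℂ)⁻¹ • W)ᴴ =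
      (t : ℂ)⁻¹ • (W * Wᴴ) := by
    rw [Matrix.conjTranspose_smul, Matrix.smul_mul, Matrix.mul_smul, smul_smul]
    congr 1
    rw [star_inv₀, Complex.star_def, Complex.conj_ofReal, ← mul_inv, hsq]
  rw [hV]
  set R := (t : ℂ)⁻¹ • (W * Wᴴ) with hR
  have hRh : Rᴴ = R := by
    rw [hR, Matrix.conjTranspose_smul, Matrix.conjTranspose_mul, Matrix.conjTranspose_conjTranspose,
      star_inv₀, Complex.star_def, Complex.conj_ofReal]
  have hPR : P * R = R := by
    rw [hR, Matrix.mul_smul, ← Matrix.mul_assoc, hPW]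
  have hRP : R * P = R := by
    have := congrArg Matrix.conjTranspose hPR
    rwa [Matrix.conjTranspose_mul, h1, hRh] at this
  have hRR : R * R = R := by
    rw [hR, Matrix.smul_mul, Matrix.mul_smul, Matrix.mul_assoc, ← Matrix.mul_assoc Wᴴ, hWW,
      Matrix.smul_mul, Matrix.one_mul, Matrix.mul_smul, smul_smul (t : ℂ)⁻¹ (t : ℂ),
      inv_mul_cancel₀ ht', one_smul]
  have hRt : R.trace = 1 := by
    rw [hR, Matrix.trace_smul, Matrix.trace_mul_comm, hWW, Matrix.trace_smul]
    simp [ht']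
  -- `R` is the orthogonal projection onto the line of a nonzero column of `P`. Then `P - R` is
  -- again a projection, of trace `1 - 1 = 0`, hence zero.
  have hz : ((P - R)ᴴ * (P - R)).trace = 0 := by
    rw [Matrix.conjTranspose_sub, h1, hRh, Matrix.sub_mul, Matrix.mul_sub, Matrix.mul_sub, h2, hPR,
      hRP, hRR]
    simp [h3, hRt]
  exact (sub_eq_zero.1 (Matrix.trace_conjTranspose_mul_self_eq_zero_iff.1 hz)).symm

/-- Choose `x i` in the group algebra acting under `ρ` as the matrix unit `E_{i o}`. Under `σ` the
element `x o` is still a projection of rank one, `V Vᴴ`, and the vectors `σ (x j) V` are the columns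
of the conjugating matrix: its matrix coefficients are traces, which agree for `ρ` and `σ`. -/
theorem exists_conj_of_chi_eq {m : ℕ} (hm : 0 < m) {ρ σ : Rep n m} (hρ : ρ.Spans)
    (h : ∀ γ, chi γ ⟨m, ρ⟩ = chi γ ⟨m, σ⟩) :
    ∃ g : Matrix.unitaryGroup (Fin m) ℂ, ∀ γ, σ γ = g * ρ γ * g⁻¹ := by
  have htr := trace_alg_eq h
  -- Equal traces and `tr (σ z (σ z)ᴴ) = 0` force `σ z = 0`, so relations pass from `ρ` to `σ`.
  have hker : ∀ z, ρ.alg z = 0 → σ.alg z = 0 := by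
    intro z hz
    obtain ⟨z', hz'⟩ := exists_alg_eq_conjTranspose z
    have h1 := htr (z * z')
    rw [map_mul, map_mul, hz, hz' m σ, Matrix.zero_mul, Matrix.trace_zero] at h1
    exact (Matrix.trace_mul_conjTranspose_self_eq_zero_iff (A := σ.alg z)).1 h1.symm
  let o : Fin m := ⟨0, hm⟩
  have hsurj : ∀ i : Fin m, ∃ x, ρ.alg x = Matrix.single i o (1 : ℂ) :=
    fun i => hρ.alg_surjective _
  choose x hx using hsurj
  have hstar := fun i : Fin m => exists_alg_eq_conjTranspose (x i)
  choose x' hx' using hstar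
  set e := x o with he
  have hP1 : (σ.alg e)ᴴ = σ.alg e := by
    rw [← hx', ← sub_eq_zero, ← map_sub]
    apply hker
    rw [map_sub, hx', hx, Matrix.conjTranspose_single]
    simp
  have hP2 : σ.alg e * σ.alg e = σ.alg e := by
    rw [← map_mul, ← sub_eq_zero, ← map_sub]
    apply hker
    rw [map_sub, map_mul, hx]
    simp
  have hP3 : (σ.alg e).trace = 1 := by
    rw [← htr, hx]
    simp
  obtain ⟨V, hV⟩ := exists_vector_of_projection hP1 hP2 hP3
  let U : Matrix (Fin m) (Fin m) ℂ := Matrix.of fun i j => (σ.alg (x j) * V) i ()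
  have hcalc : ∀ y, Uᴴ * σ.alg y * U = ρ.alg y := by
    intro y
    ext i j
    have h1 : (Uᴴ * σ.alg y * U) i j =
        ((σ.alg (x i) * V)ᴴ * σ.alg y * (σ.alg (x j) * V)) () () := by
      simp only [Matrix.mul_apply (M := _ * _), Matrix.mul_apply (M := _ᴴ),
        Matrix.conjTranspose_apply]
      rfl
    have h2 : ((σ.alg (x i) * V)ᴴ * σ.alg y * (σ.alg (x j) * V)) () () =
        (σ.alg (x' i * y * x j * e)).trace := by
      rw [map_mul, map_mul, map_mul, hx', ← hV]
      have : ∀ A : Matrix Unit Unit ℂ, A () () = A.trace := fun A => by simp [Matrix.trace]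
      refine (this _).trans ?_
      rw [← Matrix.mul_assoc _ V Vᴴ, Matrix.trace_mul_comm _ Vᴴ, Matrix.conjTranspose_mul]
      simp only [Matrix.mul_assoc]
    rw [h1, h2, ← htr, map_mul, map_mul, map_mul, hx', hx, hx, hx, Matrix.conjTranspose_single,
      Matrix.mul_assoc _ _ (single o o 1), Matrix.single_mul_single_same, Matrix.mul_assoc,
      Matrix.trace_single_mul]
    simp
  have hU1 : Uᴴ * U = 1 := by
    have := hcalc 1
    rwa [map_one, map_one, Matrix.mul_one] at this
  have hU2 : U * Uᴴ = 1 := mul_eq_one_comm.1 hU1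
  refine ⟨⟨U, Matrix.mem_unitaryGroup_iff.2 hU2⟩, fun γ => Subtype.ext ?_⟩
  have h3 := hcalc (MonoidAlgebra.single γ 1)
  rw [Rep.alg_single, Rep.alg_single, one_smul, one_smul] at h3
  change σ.mat γ = U * ρ.mat γ * Uᴴ
  rw [← h3]
  simp only [← Matrix.mul_assoc, hU2, Matrix.one_mul]
  rw [Matrix.mul_assoc, hU2, Matrix.mul_one]

end TwistedHopf

namespace TwistedHopf

variable {n : ℕ}

/-! ### Symmetric functions of characters are local fractions of the total character -/

/-- The algebra generated by the characters. -/
def charAlg (n : ℕ) : Subalgebra ℂ (RepPt n → ℂ) := Algebra.adjoin ℂ (Set.range chi)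

theorem chi_mem_charAlg (γ : LinkGroup n) : chi γ ∈ charAlg n := Algebra.subset_adjoin ⟨γ, rfl⟩

/-- The span of the alternating forms of degree `m ^ 2`. -/
def capelliSpan (n m : ℕ) : Submodule ℂ (RepPt n → ℂ) :=
  Submodule.span ℂ {f | ∃ (u : LinkGroup n) (x y : Fin (m * m) → LinkGroup n), f = capelli u x y}

theorem capelliSpan_le (m : ℕ) :
    capelliSpan n m ≤ Submodule.span ℂ (Set.range (chi (n := n))) := by
  refine Submodule.span_le.2 ?_
  rintro _ ⟨u, x, y, rfl⟩
  rw [capelli_eq_sum]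
  exact Submodule.sum_mem _ fun σ _ => Submodule.smul_mem _ _ (Submodule.subset_span ⟨_, rfl⟩)

theorem span_chi_le : Submodule.span ℂ (Set.range (chi (n := n))) ≤
    Subalgebra.toSubmodule (charAlg n) := Submodule.span_le.2 Algebra.subset_adjoin

theorem capelliSpan_eq_zero {m k : ℕ} (hk : k < m) {f : RepPt n → ℂ} (hf : f ∈ capelliSpan n m)
    (ρ : Rep n k) : f ⟨k, ρ⟩ = 0 := by
  induction hf using Submodule.span_induction with
  | mem f hf =>
    obtain ⟨u, x, y, rfl⟩ := hf
    exact capelli_eq_zero u x y (Nat.mul_self_lt_mul_self hk) ρ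
  | zero => rfl
  | add f g _ _ hf hg => simp [hf, hg]
  | smul c f _ hf => simp [hf]

/-- The product with `f` is replaced by a function agreeing with it in dimension `m` only; the
replacement is again linear in characters and vanishes in lower dimensions, which the product itself
would not help with. -/
theorem exists_capelliSpan_mul {m : ℕ} (hm : 0 < m) {φ : RepPt n → ℂ} (hφ : φ ∈ charAlg n)
    {f : RepPt n → ℂ} (hf : f ∈ capelliSpan n m) :
    ∃ g ∈ capelliSpan n m, ∀ ρ : Rep n m, g ⟨m, ρ⟩ = φ ⟨m, ρ⟩ * f ⟨m, ρ⟩ := by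
  induction hφ using Algebra.adjoin_induction generalizing f with
  | mem φ hφ =>
    obtain ⟨a, rfl⟩ := hφ
    induction hf using Submodule.span_induction with
    | mem f hf =>
      obtain ⟨u, x, y, rfl⟩ := hf
      refine ⟨(m : ℂ)⁻¹ • ∑ s, capelli u (Function.update x s (a * x s)) y,
        Submodule.smul_mem _ _ (Submodule.sum_mem _ fun s _ =>
          Submodule.subset_span ⟨_, _, _, rfl⟩), fun ρ => ?_⟩
      rw [Pi.smul_apply, Finset.sum_apply, ← chi_mul_capelli, smul_eq_mul, inv_mul_cancel_left₀]
      exact_mod_cast hm.ne'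
    | zero => exact ⟨0, Submodule.zero_mem _, by simp⟩
    | add f₁ f₂ _ _ h₁ h₂ =>
      obtain ⟨g₁, hg₁, h₁⟩ := h₁
      obtain ⟨g₂, hg₂, h₂⟩ := h₂
      exact ⟨g₁ + g₂, Submodule.add_mem _ hg₁ hg₂, fun ρ => by simp [h₁, h₂, mul_add]⟩
    | smul c f _ h =>
      obtain ⟨g, hg, h⟩ := h
      exact ⟨c • g, Submodule.smul_mem _ _ hg, fun ρ => by simp [h, mul_left_comm]⟩
  | algebraMap c => exact ⟨c • f, Submodule.smul_mem _ _ hf, fun ρ => by simp⟩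
  | add φ₁ φ₂ _ _ h₁ h₂ =>
    obtain ⟨g₁, hg₁, h₁⟩ := h₁ hf
    obtain ⟨g₂, hg₂, h₂⟩ := h₂ hf
    exact ⟨g₁ + g₂, Submodule.add_mem _ hg₁ hg₂, fun ρ => by simp [h₁, h₂, add_mul]⟩
  | mul φ₁ φ₂ _ _ h₁ h₂ =>
    obtain ⟨g₂, hg₂, h₂⟩ := h₂ hf
    obtain ⟨g₁, hg₁, h₁⟩ := h₁ hg₂
    exact ⟨g₁, hg₁, fun ρ => by simp [h₁, h₂, mul_assoc]⟩

/-- A complex vector space is not a finite union of kernels of nonzero functionals, so one form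
serves all members at once. -/
theorem exists_capelliSpan_ne_zero {m k : ℕ} (hm : 0 < m) (ρ : Fin k → Rep n m)
    (h : ∀ l, (ρ l).Spans) : ∃ f ∈ capelliSpan n m, ∀ l, f ⟨m, ρ l⟩ ≠ 0 := by
  refine Module.Dual.exists_forall_mem_ne_zero_of_forall_exists (capelliSpan n m)
    (fun l => LinearMap.proj (R := ℂ) (φ := fun _ : RepPt n => ℂ) ⟨m, ρ l⟩) fun l => ?_
  obtain ⟨u, x, y, hne⟩ := exists_capelli_ne_zero hm (h l)
  exact ⟨_, Submodule.subset_span ⟨u, x, y, rfl⟩, hne⟩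

theorem spans_of_capelliSpan_ne_zero {m : ℕ} {f : RepPt n → ℂ} (hf : f ∈ capelliSpan n m)
    {ρ : Rep n m} (h : f ⟨m, ρ⟩ ≠ 0) : ρ.Spans := by
  by_contra hc
  apply h
  induction hf using Submodule.span_induction with
  | mem f hf =>
    obtain ⟨u, x, y, rfl⟩ := hf
    by_contra h0
    exact hc (spans_of_capelli_ne_zero h0)
  | zero => rfl
  | add f g _ _ hf hg =>
    have h1 : f ⟨m, ρ⟩ = 0 := by by_contra h0; exact h0 (hf h0)
    have h2 : g ⟨m, ρ⟩ = 0 := by by_contra h0; exact h0 (hg h0)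
    simp [h1, h2]
  | smul c f _ hf =>
    have h1 : f ⟨m, ρ⟩ = 0 := by by_contra h0; exact h0 (hf h0)
    simp [h1]

variable {s : ℕ} {d a : Fin s → ℕ}

/-- Families of representations, `a i` of which have dimension `d i`. -/
abbrev Tup (n : ℕ) {s : ℕ} (d a : Fin s → ℕ) : Type := ∀ p : (Σ i, Fin (a i)), Rep n (d p.1)

/-- A member of a family. -/
def Tup.pt (y : Tup n d a) (p : Σ i, Fin (a i)) : RepPt n := ⟨d p.1, y p⟩

/-- The character of the direct sum. -/
def total (γ : LinkGroup n) (y : Tup n d a) : ℂ := ∑ p, chi γ (y.pt p)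

/-- The algebra generated by the characters of the direct sum. -/
def totalAlg (n : ℕ) {s : ℕ} (d a : Fin s → ℕ) : Subalgebra ℂ (Tup n d a → ℂ) :=
  Algebra.adjoin ℂ (Set.range total)

/-- The symmetrisation of a product of functions of the members of dimension `d i`. -/
def symSum (i : Fin s) (φ : Fin (a i) → RepPt n → ℂ) (y : Tup n d a) : ℂ :=
  ∑ σ : Equiv.Perm (Fin (a i)), ∏ l, φ l (y.pt ⟨i, σ l⟩)

/-- Symmetrise `φ` in slot `k` and `1` elsewhere. Summing over `k`, rather than fixing a slot, also
covers `a i = 0`. -/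
theorem sum_mem_of_symSum_mem {A : Subalgebra ℂ (Tup n d a → ℂ)} {i : Fin s}
    (h : ∀ φ : Fin (a i) → RepPt n → ℂ, (∀ l, φ l ∈ charAlg n) → symSum i φ ∈ A)
    {φ : RepPt n → ℂ} (hφ : φ ∈ charAlg n) :
    (fun y : Tup n d a => ∑ l, φ (y.pt ⟨i, l⟩)) ∈ A := by
  have h1 : ((a i).factorial : ℂ)⁻¹ • ∑ k, symSum (d := d) i (Function.update 1 k φ) ∈ A := by
    refine A.smul_mem (sum_mem fun k _ => h _ fun l => ?_) _
    by_cases hl : l = k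
    · subst hl; simpa using hφ
    · rw [Function.update_of_ne hl]; exact (charAlg n).one_mem
  convert h1 using 1
  ext y
  have h2 : ∀ (k : Fin (a i)) (σ : Equiv.Perm (Fin (a i))),
      ∏ l, (Function.update 1 k φ : Fin (a i) → RepPt n → ℂ) l (y.pt ⟨i, σ l⟩) =
        φ (y.pt ⟨i, σ k⟩) := by
    intro k σ
    rw [Finset.prod_eq_single k]
    · simp
    · intro l _ hl
      simp [Function.update_of_ne hl]
    · simp
  rw [Pi.smul_apply, Finset.sum_apply, smul_eq_mul]
  simp only [symSum, h2]
  rw [Finset.sum_comm]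
  have h3 : ∀ σ : Equiv.Perm (Fin (a i)), ∑ k, φ (y.pt ⟨i, σ k⟩) = ∑ k, φ (y.pt ⟨i, k⟩) :=
    fun σ => Equiv.sum_comp σ fun k => φ (y.pt ⟨i, k⟩)
  simp only [h3, Finset.sum_const, Finset.card_univ, Fintype.card_perm, Fintype.card_fin,
    nsmul_eq_mul]
  rw [inv_mul_cancel_left₀]
  exact_mod_cast (a i).factorial_ne_zero

theorem sum_span_chi_mem {f : RepPt n → ℂ} (hf : f ∈ Submodule.span ℂ (Set.range (chi (n := n)))) :
    (fun y : Tup n d a => ∑ p, f (y.pt p)) ∈ totalAlg n d a := by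
  induction hf using Submodule.span_induction with
  | mem f hf =>
    obtain ⟨γ, rfl⟩ := hf
    exact Algebra.subset_adjoin ⟨γ, rfl⟩
  | zero => simp only [Pi.zero_apply, Finset.sum_const_zero]; exact (totalAlg n d a).zero_mem
  | add f g _ _ hf hg =>
    simp only [Pi.add_apply, Finset.sum_add_distrib]
    exact add_mem hf hg
  | smul c f _ hf =>
    simp only [Pi.smul_apply, ← Finset.smul_sum]
    exact (totalAlg n d a).smul_mem hf c

/-- Induction on `i` treats larger dimensions first. Power sums of Capelli functions over the
members of dimension `d i` come from total characters, `sum_perm_prod_mem` turns them into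
symmetrised products, and a form `h` nonzero at every member of `y₀` of dimension `d i` is finally
divided out. -/
theorem symSum_mem_fracAt (hd : StrictAnti d) (hpos : ∀ i, 0 < d i) {y₀ : Tup n d a}
    (hy₀ : ∀ p, (y₀ p).Spans) (i : Fin s) (φ : Fin (a i) → RepPt n → ℂ)
    (hφ : ∀ l, φ l ∈ charAlg n) : symSum i φ ∈ fracAt (totalAlg n d a) Set.univ y₀ := by
  induction i using WellFoundedLT.induction with
  | ind i ih =>
  set A := fracAt (totalAlg n d a) Set.univ y₀ with hA
  have hsum : ∀ f ∈ capelliSpan n (d i), (fun y : Tup n d a => ∑ l, f (y.pt ⟨i, l⟩)) ∈ A := by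
    intro f hf
    -- In the total sum of `f`, members of smaller dimension (`j > i`) contribute zero, and those of
    -- larger dimension (`j < i`) are known by induction.
    have h1 : (fun y : Tup n d a => ∑ l, f (y.pt ⟨i, l⟩)) =
        (fun y => ∑ p, f (y.pt p)) -
          ∑ j ∈ Finset.univ.filter (· < i), fun y => ∑ l, f (y.pt ⟨j, l⟩) := by
      ext y
      rw [Pi.sub_apply, Finset.sum_apply, Fintype.sum_sigma, eq_sub_iff_add_eq, Finset.sum_filter,
        ← Finset.add_sum_erase _ (fun j => ∑ l, f (y.pt ⟨j, l⟩)) (Finset.mem_univ i),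
        ← Finset.add_sum_erase _ (fun j => ite (j < i) _ _) (Finset.mem_univ i)]
      rw [if_neg (lt_irrefl i), zero_add]
      congr 1
      refine Finset.sum_congr rfl fun j hj => ?_
      split_ifs with hji
      · rfl
      · have hlt : i < j := lt_of_le_of_ne (not_lt.1 hji) (Finset.ne_of_mem_erase hj).symm
        exact (Finset.sum_eq_zero fun l _ => capelliSpan_eq_zero (hd hlt) hf _).symm
    rw [h1]
    refine sub_mem (le_fracAt (sum_span_chi_mem (capelliSpan_le _ hf))) (sum_mem fun j hj => ?_)
    exact sum_mem_of_symSum_mem (fun φ hφ => ih j (Finset.mem_filter.1 hj).2 φ hφ)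
      (span_chi_le (capelliSpan_le _ hf))
  have hcap : ∀ ψ : Fin (a i) → RepPt n → ℂ, (∀ l, ψ l ∈ capelliSpan n (d i)) →
      symSum i ψ ∈ A := by
    intro ψ hψ
    have h := sum_perm_prod_mem A
      {F | ∃ f ∈ capelliSpan n (d i), F = fun l (y : Tup n d a) => f (y.pt ⟨i, l⟩)}
      (by
        rintro _ ⟨f, hf, rfl⟩ _ ⟨g, hg, rfl⟩
        obtain ⟨h, hh, H⟩ := exists_capelliSpan_mul (hpos i) (span_chi_le (capelliSpan_le _ hf)) hg
        refine ⟨h, hh, ?_⟩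
        ext l y
        exact (H _).symm)
      (by
        rintro _ ⟨f, hf, rfl⟩
        convert hsum f hf using 1
        ext y
        simp)
      (fun l k y => ψ l (y.pt ⟨i, k⟩)) fun l => ⟨ψ l, hψ l, rfl⟩
    convert h using 1
    ext y
    simp [symSum]
  obtain ⟨h, hh, hne⟩ := exists_capelliSpan_ne_zero (hpos i) (fun l => y₀ ⟨i, l⟩) fun l => hy₀ _
  choose g hg hgmul using fun l => exists_capelliSpan_mul (hpos i) (hφ l) hh
  have hconst : ∀ y : Tup n d a, symSum i (fun _ => h) y =
      (a i).factorial * ∏ l, h (y.pt ⟨i, l⟩) := by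
    intro y
    have : ∀ σ : Equiv.Perm (Fin (a i)), ∏ l, h (y.pt ⟨i, σ l⟩) = ∏ l, h (y.pt ⟨i, l⟩) :=
      fun σ => Equiv.prod_comp σ fun k => h (y.pt ⟨i, k⟩)
    simp [symSum, this, Fintype.card_perm]
  -- The product of `h` over all members is symmetric, so it multiplies `φ` inside the
  -- symmetrisation and turns each factor into a Capelli function `g l`.
  refine fracAt_of_mul (Set.mem_univ _) (hcap (fun _ => h) fun _ => hh)
    (A.smul_mem (hcap g hg) ((a i).factorial : ℂ)) ?_ fun y _ => ?_
  · rw [hconst]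
    refine mul_ne_zero (by exact_mod_cast (a i).factorial_ne_zero)
      (Finset.prod_ne_zero_iff.2 fun l _ => hne l)
  · rw [hconst, Pi.smul_apply, smul_eq_mul, mul_assoc, symSum, symSum, Finset.mul_sum]
    congr 1
    refine Finset.sum_congr rfl fun σ _ => ?_
    have h1 : ∀ l, g l (y.pt ⟨i, σ l⟩) = φ l (y.pt ⟨i, σ l⟩) * h (y.pt ⟨i, σ l⟩) :=
      fun l => hgmul l _
    simp only [h1, Finset.prod_mul_distrib]
    rw [Equiv.prod_comp σ fun k => h (y.pt ⟨i, k⟩), mul_comm]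

/-! ### Uniqueness of the decomposition -/

theorem symSum_eq_of_total_eq (hd : StrictAnti d) (hpos : ∀ i, 0 < d i) {y₀ y₁ : Tup n d a}
    (hy₀ : ∀ p, (y₀ p).Spans) (h : ∀ γ, total γ y₁ = total γ y₀) (i : Fin s)
    (φ : Fin (a i) → RepPt n → ℂ) (hφ : ∀ l, φ l ∈ charAlg n) :
    symSum i φ y₁ = symSum i φ y₀ := by
  refine eq_of_mem_fracAt (fun f hf => ?_) (symSum_mem_fracAt hd hpos hy₀ i φ hφ)
  refine eqOn_adjoin ?_ hf
  rintro _ ⟨γ, rfl⟩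
  exact h γ

/-- The product of a Capelli function over the members of dimension `d i` is determined by the total
character; it is nonzero at `y₀`, hence at `y₁`. No irreducibility of `y₁` is presupposed, as the
closedness argument requires. -/
theorem spans_of_total_eq (hd : StrictAnti d) (hpos : ∀ i, 0 < d i) {y₀ y₁ : Tup n d a}
    (hy₀ : ∀ p, (y₀ p).Spans) (h : ∀ γ, total γ y₁ = total γ y₀) (p : Σ i, Fin (a i)) :
    (y₁ p).Spans := by
  obtain ⟨i, l⟩ := p
  obtain ⟨f, hf, hne⟩ := exists_capelliSpan_ne_zero (hpos i) (fun l => y₀ ⟨i, l⟩) fun l => hy₀ _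
  have h1 := symSum_eq_of_total_eq hd hpos hy₀ h i (fun _ => f)
    fun _ => span_chi_le (capelliSpan_le _ hf)
  have h2 : ∀ (y : Tup n d a) (σ : Equiv.Perm (Fin (a i))),
      ∏ l, f (y.pt ⟨i, σ l⟩) = ∏ l, f (y.pt ⟨i, l⟩) :=
    fun y σ => Equiv.prod_comp σ fun k => f (y.pt ⟨i, k⟩)
  simp only [symSum, h2, Finset.sum_const, Finset.card_univ, nsmul_eq_mul] at h1
  have h3 := mul_left_cancel₀ (by exact_mod_cast Fintype.card_ne_zero) h1
  have h4 : ∏ l, f (y₁.pt ⟨i, l⟩) ≠ 0 := by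
    rw [h3]
    exact Finset.prod_ne_zero_iff.2 fun l _ => hne l
  exact spans_of_capelliSpan_ne_zero hf (Finset.prod_ne_zero_iff.1 h4 l (Finset.mem_univ _))

theorem exists_charAlg_indicator (V : Finset (LinkGroup n → ℂ)) (v : LinkGroup n → ℂ) :
    ∃ φ ∈ charAlg n, ∀ z : RepPt n, (fun γ => chi γ z) ∈ V →
      φ z = open Classical in if (fun γ => chi γ z) = v then 1 else 0 := by
  classical
  have h : ∀ w : LinkGroup n → ℂ, ∃ γ, w ≠ v → v γ ≠ w γ := by
    intro w
    by_cases hw : w = v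
    · exact ⟨1, fun h => absurd hw h⟩
    · obtain ⟨γ, hγ⟩ := Function.ne_iff.1 hw
      exact ⟨γ, fun _ => hγ.symm⟩
  choose γ hγ using h
  -- Lagrange interpolation, with `γ w` a group element on which the characters `w` and `v` differ.
  refine ⟨∏ w ∈ V.erase v, (v (γ w) - w (γ w))⁻¹ • (chi (γ w) - algebraMap ℂ _ (w (γ w))),
    prod_mem fun w _ => Subalgebra.smul_mem _ (sub_mem (chi_mem_charAlg _)
      (Subalgebra.algebraMap_mem _ _)) _, fun z hz => ?_⟩
  rw [Finset.prod_apply]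
  split_ifs with hv
  · refine Finset.prod_eq_one fun w hw => ?_
    have h1 : chi (γ w) z = v (γ w) := congrFun hv _
    have h2 := sub_ne_zero.2 (hγ w (Finset.ne_of_mem_erase hw))
    simp [h1, h2]
  · refine Finset.prod_eq_zero (Finset.mem_erase.2 ⟨hv, hz⟩) ?_
    simp

/-- The number of members with a given character is a sum of values of an indicator in `charAlg`, so
it depends only on the total character. Matching the fibres gives the permutation. -/
theorem exists_perm_of_total_eq (hd : StrictAnti d) (hpos : ∀ i, 0 < d i) {y₀ y₁ : Tup n d a}
    (hy₀ : ∀ p, (y₀ p).Spans) (h : ∀ γ, total γ y₁ = total γ y₀) (i : Fin s) :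
    ∃ σ : Equiv.Perm (Fin (a i)), ∀ l γ, chi γ (y₁.pt ⟨i, σ l⟩) = chi γ (y₀.pt ⟨i, l⟩) := by
  classical
  let v : Tup n d a → Fin (a i) → LinkGroup n → ℂ := fun y l γ => chi γ (y.pt ⟨i, l⟩)
  have key : ∀ w, Fintype.card {l // v y₀ l = w} = Fintype.card {l // v y₁ l = w} := by
    intro w
    obtain ⟨φ, hφ, H⟩ := exists_charAlg_indicator
      (Finset.univ.image (v y₀) ∪ Finset.univ.image (v y₁)) w
    have h1 := eq_of_mem_fracAt (y := y₁) (z₀ := y₀) (S := totalAlg n d a)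
      (fun f hf => eqOn_adjoin (by rintro _ ⟨γ, rfl⟩; exact h γ) hf)
      (sum_mem_of_symSum_mem (i := i) (symSum_mem_fracAt hd hpos hy₀ i) hφ)
    have h2 : ∀ l, φ (y₀.pt ⟨i, l⟩) = if v y₀ l = w then 1 else 0 := fun l => by
      rw [H _ (Finset.mem_union_left _ (Finset.mem_image_of_mem (v y₀) (Finset.mem_univ l)))]
    have h3 : ∀ l, φ (y₁.pt ⟨i, l⟩) = if v y₁ l = w then 1 else 0 := fun l => by
      rw [H _ (Finset.mem_union_right _ (Finset.mem_image_of_mem (v y₁) (Finset.mem_univ l)))]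
    simp only [h2, h3, Finset.sum_boole] at h1
    rw [Fintype.card_subtype, Fintype.card_subtype]
    exact_mod_cast h1.symm
  let e := fun w => Fintype.equivOfCardEq (key w)
  refine ⟨Equiv.ofFiberEquiv e, fun l γ => ?_⟩
  exact congrFun (Equiv.ofFiberEquiv_map e l) γ

end TwistedHopf

namespace TwistedHopf

open Matrix

variable {n : ℕ}

/-! ### Invariant functions of families of representations -/

/-- Conjugation by a unitary matrix. -/
def Rep.conj {m : ℕ} (g : Matrix.unitaryGroup (Fin m) ℂ) (ρ : Rep n m) : Rep n m :=
  (MulAut.conj g).toMonoidHom.comp ρ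

theorem Rep.conj_apply {m : ℕ} (g : Matrix.unitaryGroup (Fin m) ℂ) (ρ : Rep n m)
    (γ : LinkGroup n) : ρ.conj g γ = g * ρ γ * g⁻¹ := rfl

theorem Rep.mat_conj {m : ℕ} (g : Matrix.unitaryGroup (Fin m) ℂ) (ρ : Rep n m)
    (γ : LinkGroup n) : (ρ.conj g).mat γ = g.1 * ρ.mat γ * g.1ᴴ := rfl

theorem Rep.alg_conj {m : ℕ} (g : Matrix.unitaryGroup (Fin m) ℂ) (ρ : Rep n m)
    (x : MonoidAlgebra ℂ (LinkGroup n)) : (ρ.conj g).alg x = g.1 * ρ.alg x * g.1ᴴ := by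
  induction x using MonoidAlgebra.induction_linear with
  | zero => simp
  | add x y hx hy => rw [map_add, map_add, hx, hy, Matrix.mul_add, Matrix.add_mul]
  | single γ t =>
    rw [Rep.alg_single, Rep.alg_single, Rep.mat_conj, Matrix.mul_smul, Matrix.smul_mul]

theorem Rep.trace_alg_conj {m : ℕ} (g : Matrix.unitaryGroup (Fin m) ℂ) (ρ : Rep n m)
    (x : MonoidAlgebra ℂ (LinkGroup n)) : ((ρ.conj g).alg x).trace = (ρ.alg x).trace := by
  have h : g.1ᴴ * g.1 = 1 := Matrix.mem_unitaryGroup_iff'.1 g.2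
  rw [Rep.alg_conj, Matrix.mul_assoc, Matrix.trace_mul_comm, Matrix.mul_assoc, h, Matrix.mul_one]

theorem Rep.conj_one {m : ℕ} (ρ : Rep n m) : ρ.conj 1 = ρ := by
  ext1 γ
  simp [Rep.conj_apply]

theorem Rep.chi_conj {m : ℕ} (g : Matrix.unitaryGroup (Fin m) ℂ) (ρ : Rep n m) (γ : LinkGroup n) :
    chi γ ⟨m, ρ.conj g⟩ = chi γ ⟨m, ρ⟩ := by
  have := ρ.trace_alg_conj g (MonoidAlgebra.single γ 1)
  simpa [Rep.alg_single, chi] using this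

theorem Rep.Spans.conj {m : ℕ} {ρ : Rep n m} (h : ρ.Spans) (g : Matrix.unitaryGroup (Fin m) ℂ) :
    (ρ.conj g).Spans := by
  rw [Rep.Spans, eq_top_iff]
  rintro X -
  obtain ⟨x, hx⟩ := h.alg_surjective (g.1ᴴ * X * g.1)
  have hg : g.1 * g.1ᴴ = 1 := Matrix.mem_unitaryGroup_iff.1 g.2
  have h1 : (ρ.conj g).alg x = X := by
    rw [Rep.alg_conj, hx]
    simp only [Matrix.mul_assoc, hg, Matrix.mul_one]
    rw [← Matrix.mul_assoc, hg, Matrix.one_mul]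
  rw [← h1]
  clear h1 hx
  induction x using MonoidAlgebra.induction_linear with
  | zero => simp
  | add x y hx hy => rw [map_add]; exact add_mem hx hy
  | single γ t =>
    rw [Rep.alg_single]
    exact Submodule.smul_mem _ _ (Submodule.subset_span ⟨γ, rfl⟩)

variable {κ : Type*} {D : κ → ℕ}

/-- Families of representations of dimensions `D k`. -/
abbrev Fam (n : ℕ) {κ : Type*} (D : κ → ℕ) : Type _ := ∀ k, Rep n (D k)

/-- Conjugation of the members of a family. -/
def Fam.conj (g : ∀ k, Matrix.unitaryGroup (Fin (D k)) ℂ) (y : Fam n D) : Fam n D :=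
  fun k => (y k).conj (g k)

/-- A matrix entry of a member of a family. -/
def entry (k : κ) (γ : LinkGroup n) (i j : Fin (D k)) (y : Fam n D) : ℂ := (y k).mat γ i j

/-- The algebra generated by the matrix entries. -/
def entryAlg (n : ℕ) {κ : Type*} (D : κ → ℕ) : Subalgebra ℂ (Fam n D → ℂ) :=
  Algebra.adjoin ℂ {f | ∃ k γ i j, f = entry k γ i j}

/-- The character of a member of a family. -/
def famChar (k : κ) (γ : LinkGroup n) (y : Fam n D) : ℂ := chi γ ⟨D k, y k⟩

/-- The algebra generated by the characters of the members. -/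
def famCharAlg (n : ℕ) {κ : Type*} (D : κ → ℕ) : Subalgebra ℂ (Fam n D → ℂ) :=
  Algebra.adjoin ℂ {f | ∃ k γ, f = famChar k γ}

/-- A diagonal entry of the matrix of the element `e k` of the group algebra. -/
noncomputable def eig (e : κ → MonoidAlgebra ℂ (LinkGroup n)) (k : κ) (i : Fin (D k))
    (y : Fam n D) : ℂ := (y k).alg (e k) i i

/-- The algebra generated by the characters of the members and the diagonal entries `eig`. -/
noncomputable def eigAlg {κ : Type*} (D : κ → ℕ) (e : κ → MonoidAlgebra ℂ (LinkGroup n)) :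
    Subalgebra ℂ (Fam n D → ℂ) :=
  Algebra.adjoin ℂ ({f | ∃ k γ, f = famChar k γ} ∪ {f | ∃ k i, f = eig e k i})

theorem trace_alg_mem_famCharAlg (k : κ) (x : MonoidAlgebra ℂ (LinkGroup n)) :
    (fun y : Fam n D => ((y k).alg x).trace) ∈ famCharAlg n D := by
  have h := trace_alg_mem x
  exact Submodule.span_induction
    (p := fun f _ => (fun y : Fam n D => f ⟨D k, y k⟩) ∈ famCharAlg n D)
    (by rintro _ ⟨γ, rfl⟩; exact Algebra.subset_adjoin ⟨k, γ, rfl⟩)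
    (famCharAlg n D).zero_mem (fun f g _ _ hf hg => add_mem hf hg)
    (fun c f _ hf => (famCharAlg n D).smul_mem hf c) h

theorem star_mem_entryAlg {f : Fam n D → ℂ} (hf : f ∈ entryAlg n D) : star f ∈ entryAlg n D := by
  refine star_mem_adjoin ?_ hf
  rintro _ ⟨k, γ, i, j, rfl⟩
  refine Algebra.subset_adjoin ⟨k, γ⁻¹, j, i, ?_⟩
  ext y
  simp [entry, Rep.mat_inv]

theorem star_mem_eigAlg {e : κ → MonoidAlgebra ℂ (LinkGroup n)}
    (he : ∀ k (ρ : Rep n (D k)), (ρ.alg (e k)).IsHermitian) {f : Fam n D → ℂ}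
    (hf : f ∈ eigAlg D e) : star f ∈ eigAlg D e := by
  refine star_mem_adjoin ?_ hf
  rintro _ (⟨k, γ, rfl⟩ | ⟨k, i, rfl⟩)
  · refine Algebra.subset_adjoin (Or.inl ⟨k, γ⁻¹, ?_⟩)
    ext y
    exact congrFun (star_chi γ) _
  · refine Algebra.subset_adjoin (Or.inr ⟨k, i, ?_⟩)
    ext y
    exact (he k (y k)).apply i i

theorem famCharAlg_le_eigAlg {e : κ → MonoidAlgebra ℂ (LinkGroup n)} :
    famCharAlg n D ≤ eigAlg D e := Algebra.adjoin_mono Set.subset_union_left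

theorem famCharAlg_conj {f : Fam n D → ℂ} (hf : f ∈ famCharAlg n D)
    (g : ∀ k, Matrix.unitaryGroup (Fin (D k)) ℂ) (y : Fam n D) : f (y.conj g) = f y := by
  refine eqOn_adjoin ?_ hf
  rintro _ ⟨k, γ, rfl⟩
  exact Rep.chi_conj _ _ _

/-! ### The torus -/

section torus

variable (B : Subalgebra ℂ (Fam n D → ℂ))

/-- The products of a function in `B` and the matrix function of a group element. -/
def matMonoid (k : κ) : Submonoid (Fam n D → Matrix (Fin (D k)) (Fin (D k)) ℂ) where
  carrier := {X | ∃ b ∈ B, ∃ γ, X = fun y => b y • (y k).mat γ}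
  one_mem' := ⟨1, B.one_mem, 1, by ext; simp⟩
  mul_mem' := by
    rintro _ _ ⟨b, hb, γ, rfl⟩ ⟨b', hb', γ', rfl⟩
    refine ⟨b * b', mul_mem hb hb', γ * γ', ?_⟩
    ext1 y
    simp [smul_smul, mul_comm]

/-- The matrix functions that are combinations of group elements with coefficients in `B`. -/
def matFun (k : κ) : Subsemiring (Fam n D → Matrix (Fin (D k)) (Fin (D k)) ℂ) :=
  (matMonoid B k).subsemiringClosure

variable {B}

theorem smul_mat_mem_matFun {k : κ} {b : Fam n D → ℂ} (hb : b ∈ B) (γ : LinkGroup n) :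
    (fun y : Fam n D => b y • (y k).mat γ) ∈ matFun B k :=
  AddSubmonoid.subset_closure ⟨b, hb, γ, rfl⟩

theorem alg_mem_matFun (k : κ) (x : MonoidAlgebra ℂ (LinkGroup n)) :
    (fun y : Fam n D => (y k).alg x) ∈ matFun B k := by
  induction x using MonoidAlgebra.induction_linear with
  | zero => simp only [map_zero]; exact (matFun B k).zero_mem
  | add x y hx hy => simp only [map_add]; exact add_mem hx hy
  | single γ t =>
    simp only [Rep.alg_single]
    exact smul_mat_mem_matFun (B.algebraMap_mem t) γ

theorem smul_one_mem_matFun {k : κ} {b : Fam n D → ℂ} (hb : b ∈ B) :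
    (fun y : Fam n D => b y • (1 : Matrix (Fin (D k)) (Fin (D k)) ℂ)) ∈ matFun B k := by
  simpa using! smul_mat_mem_matFun (k := k) hb 1

theorem trace_matFun_mem (hB : famCharAlg n D ≤ B) {k : κ}
    {X : Fam n D → Matrix (Fin (D k)) (Fin (D k)) ℂ} (hX : X ∈ matFun B k) :
    (fun y => (X y).trace) ∈ B := by
  refine AddSubmonoid.closure_induction (motive := fun X _ => (fun y => (X y).trace) ∈ B) ?_ ?_ ?_ hX
  · rintro _ ⟨b, hb, γ, rfl⟩
    simp only [Matrix.trace_smul, smul_eq_mul]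
    exact mul_mem hb (hB (Algebra.subset_adjoin ⟨k, γ, rfl⟩))
  · simp only [Pi.zero_apply, Matrix.trace_zero]
    exact B.zero_mem
  · intro X Y _ _ hX hY
    simp only [Pi.add_apply, Matrix.trace_add]
    exact add_mem hX hY

variable {e : κ → MonoidAlgebra ℂ (LinkGroup n)} {U : Set (Fam n D)} {z₀ : Fam n D}

/-- Up to a denominator, the spectral projections of a diagonal matrix with distinct eigenvalues
are polynomials in the matrix and the eigenvalues. -/
theorem exists_projection (hB : eigAlg D e ≤ B)
    (hU : ∀ y ∈ U, ∀ k, ((y k).alg (e k)).IsDiag)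
    (hinj : ∀ k, Function.Injective fun i => eig e k i z₀) (k : κ) (j : Fin (D k)) :
    ∃ E ∈ matFun B k, ∃ c ∈ B, c z₀ ≠ 0 ∧ ∀ y ∈ U, E y = single j j (c y) := by
  have heig : ∀ i, eig e k i ∈ B := fun i => hB (Algebra.subset_adjoin (Or.inr ⟨k, i, rfl⟩))
  let L := (Finset.univ.erase j).toList
  refine ⟨(L.map fun j' y => (y k).alg (e k) +
      (-eig e k j') y • (1 : Matrix (Fin (D k)) (Fin (D k)) ℂ)).prod, ?_,
    ∏ j' ∈ Finset.univ.erase j, (eig e k j - eig e k j'),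
    prod_mem fun j' _ => sub_mem (heig j) (heig j'), ?_, fun y hy => ?_⟩
  · refine list_prod_mem ?_
    intro x hx
    obtain ⟨j', _, rfl⟩ := List.mem_map.1 hx
    exact add_mem (alg_mem_matFun k (e k)) (smul_one_mem_matFun (neg_mem (heig j')))
  · rw [Finset.prod_apply]
    refine Finset.prod_ne_zero_iff.2 fun j' hj' => ?_
    rw [Pi.sub_apply, sub_ne_zero]
    exact fun h => Finset.ne_of_mem_erase hj' (hinj k h).symm
  · have h1 : ∀ j', (y k).alg (e k) + (-eig e k j') y • (1 : Matrix (Fin (D k)) (Fin (D k)) ℂ) =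
        diagonalRingHom _ ℂ (fun i => eig e k i y - eig e k j' y) := by
      intro j'
      rw [← (hU y hy k).diagonal_diag, ← Matrix.diagonal_one, ← Matrix.diagonal_smul,
        Matrix.diagonal_add]
      simp only [diagonalRingHom_apply]
      congr 1
      ext i
      simp [eig, sub_eq_add_neg]
    have h2 := map_list_prod (Pi.evalMonoidHom (fun _ : Fam n D =>
      Matrix (Fin (D k)) (Fin (D k)) ℂ) y) (L.map fun j' y => (y k).alg (e k) +
      (-eig e k j') y • (1 : Matrix (Fin (D k)) (Fin (D k)) ℂ))
    rw [List.map_map] at h2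
    refine h2.trans ?_
    have h3 : (L.map ((Pi.evalMonoidHom (fun _ : Fam n D => Matrix (Fin (D k)) (Fin (D k)) ℂ) y) ∘
        fun j' y => (y k).alg (e k) + (-eig e k j') y • (1 : Matrix (Fin (D k)) (Fin (D k)) ℂ))) =
        (L.map fun j' i => eig e k i y - eig e k j' y).map (diagonalRingHom _ ℂ) := by
      rw [List.map_map]
      exact List.map_congr_left fun j' _ => h1 j'
    rw [h3, ← map_list_prod, diagonalRingHom_apply, Finset.prod_map_toList]
    ext p q
    rw [Matrix.diagonal_apply, Matrix.single_apply]
    by_cases hpq : p = q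
    · subst hpq
      rw [if_pos rfl, Finset.prod_apply]
      by_cases hpj : j = p
      · subst hpj
        simp
      · rw [if_neg (by simp [hpj])]
        exact Finset.prod_eq_zero (Finset.mem_erase.2 ⟨Ne.symm hpj, Finset.mem_univ _⟩) (sub_self _)
    · rw [if_neg hpq, if_neg]
      rintro ⟨rfl, rfl⟩
      exact hpq rfl

/-- A matrix function together with a row and a column index. -/
abbrev MatEntry (n : ℕ) {κ : Type*} (D : κ → ℕ) : Type _ :=
  Σ k : κ, (Fam n D → Matrix (Fin (D k)) (Fin (D k)) ℂ) × Fin (D k) × Fin (D k)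

/-- The row index. -/
def MatEntry.src (t : MatEntry n D) : Σ k, Fin (D k) := ⟨t.1, t.2.2.1⟩

/-- The column index. -/
def MatEntry.tgt (t : MatEntry n D) : Σ k, Fin (D k) := ⟨t.1, t.2.2.2⟩

/-- The entry. -/
def MatEntry.val (t : MatEntry n D) (y : Fam n D) : ℂ := t.2.1 y t.2.2.1 t.2.2.2

/-- A product of entries that is invariant under diagonal matrices is expressed by traces. -/
theorem prod_val_mem_fracAt (hz : z₀ ∈ U)
    (hU : ∀ y ∈ U, ∀ k, ((y k).alg (e k)).IsDiag)
    (hinj : ∀ k, Function.Injective fun i => eig e k i z₀) (L : List (MatEntry n D))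
    (hL : ∀ t ∈ L, t.2.1 ∈ matFun (fracAt (eigAlg D e) U z₀) t.1)
    (hperm : (L.map MatEntry.src).Perm (L.map MatEntry.tgt)) :
    (L.map MatEntry.val).prod ∈ fracAt (eigAlg D e) U z₀ := by
  classical
  set B := fracAt (eigAlg D e) U z₀ with hB
  have hle : eigAlg D e ≤ B := le_fracAt
  induction hlen : L.length using Nat.strong_induction_on generalizing L with
  | _ N ih =>
  match L, hL, hperm, hlen with
  | [], _, _, _ => exact B.one_mem
  | ⟨k, X, i, j⟩ :: T, hL, hperm, hlen =>
    have hX : X ∈ matFun B k := hL _ List.mem_cons_self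
    have hT : ∀ t ∈ T, t.2.1 ∈ matFun B t.1 := fun t ht => hL t (List.mem_cons_of_mem _ ht)
    simp only [List.map_cons, MatEntry.src, MatEntry.tgt] at hperm
    -- A diagonal entry is `tr (X E_jj)`. For an off-diagonal entry, balance supplies an entry of
    -- `Y` in row `j`, and `X_ij Y_jl = (X E_jj Y)_il` merges the two, shortening the list. The
    -- projections `E_jj` are available up to a denominator.
    by_cases hij : j = i
    · subst hij
      rw [List.map_cons, List.prod_cons]
      refine mul_mem ?_ (ih T.length (by rw [← hlen]; simp) T
        ((List.perm_cons _).1 hperm) hT rfl)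
      obtain ⟨E, hE, c, hc, hc0, hEc⟩ := exists_projection hle hU hinj k j
      refine fracAt_of_mul hz hc (trace_matFun_mem (famCharAlg_le_eigAlg.trans hle)
        (mul_mem hX hE)) hc0 fun y hy => ?_
      rw [Pi.mul_apply, hEc y hy, Matrix.trace_mul_single]
      simp [MatEntry.val, mul_comm]
    · have hmem : (⟨k, j⟩ : Σ k, Fin (D k)) ∈ T.map MatEntry.src := by
        have h1 : (⟨k, j⟩ : Σ k, Fin (D k)) ∈ (⟨k, i⟩ : Σ k, Fin (D k)) :: T.map MatEntry.src :=
          hperm.mem_iff.2 List.mem_cons_self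
        rcases List.mem_cons.1 h1 with h2 | h2
        · exact absurd (eq_of_heq (Sigma.mk.inj h2).2) hij
        · exact h2
      obtain ⟨⟨k', Y, j', l⟩, ht, hsrc⟩ := List.mem_map.1 hmem
      obtain ⟨rfl, hj'⟩ := Sigma.mk.inj hsrc
      obtain rfl := eq_of_heq hj'
      obtain ⟨T₁, T₂, rfl⟩ := List.append_of_mem ht
      obtain ⟨E, hE, c, hc, hc0, hEc⟩ := exists_projection hle hU hinj k' j'
      have hY : Y ∈ matFun B k' := hT _ ht
      have h3 := ih (T₁ ++ T₂).length.succ (by rw [← hlen]; simp)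
        (⟨k', X * E * Y, i, l⟩ :: (T₁ ++ T₂)) (by
          have h4 := hperm
          simp only [List.map_append, List.map_cons, MatEntry.src, MatEntry.tgt] at h4 ⊢
          rw [List.perm_iff_count] at h4 ⊢
          intro ω
          have := h4 ω
          simp only [List.count_cons, List.count_append] at this ⊢
          omega) (by
          intro t ht'
          rcases List.mem_cons.1 ht' with rfl | ht'
          · exact mul_mem (mul_mem hX hE) hY
          · refine hT t ?_
            rw [List.mem_append] at ht' ⊢
            rcases ht' with h | h
            · exact Or.inl h
            · exact Or.inr (List.mem_cons_of_mem _ h)) rfl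
      refine fracAt_of_mul hz hc h3 hc0 fun y hy => ?_
      simp only [List.map_cons, List.map_append, List.prod_cons, List.prod_append, Pi.mul_apply,
        MatEntry.val]
      have h5 : (X y * E y * Y y) i l = c y * (X y i j' * Y y j' l) := by
        rw [hEc y hy, Matrix.mul_assoc, Matrix.mul_apply, Finset.sum_eq_single j']
        · rw [Matrix.single_mul_apply_same]; ring
        · intro b _ hb
          rw [Matrix.single_mul_apply_of_ne _ _ _ _ _ hb, mul_zero]
        · simp
      rw [h5]
      ring

end torus

end TwistedHopf

/-! ### Averaging over a finite torus of roots of unity -/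

namespace TwistedHopf

open Matrix

variable {n : ℕ} {κ : Type*} {D : κ → ℕ}

/-- A unitary diagonal matrix. -/
def unitaryDiagonal {m : ℕ} (t : Fin m → ℂ) (ht : ∀ i, t i * star (t i) = 1) :
    Matrix.unitaryGroup (Fin m) ℂ :=
  ⟨diagonal t, by
    rw [Matrix.mem_unitaryGroup_iff, Matrix.star_eq_conjTranspose, Matrix.diagonal_conjTranspose,
      Matrix.diagonal_mul_diagonal, ← Matrix.diagonal_one]
    congr 1
    ext i
    exact ht i⟩

theorem rootsOfUnity_mul_star {M : ℕ} [NeZero M] (ζ : rootsOfUnity M ℂ) :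
    ((ζ : ℂˣ) : ℂ) * star ((ζ : ℂˣ) : ℂ) = 1 := by
  rw [Complex.star_def, Complex.conj_rootsOfUnity ζ.2]
  simp

/-- The action of a torus of roots of unity. -/
def torusAct {M : ℕ} [NeZero M] (t : (Σ k, Fin (D k)) → rootsOfUnity M ℂ) (y : Fam n D) :
    Fam n D :=
  y.conj fun k => unitaryDiagonal (fun i => ((t ⟨k, i⟩ : ℂˣ) : ℂ)) fun i => rootsOfUnity_mul_star (t ⟨k, i⟩)

/-- A coordinate of the torus. -/
def torusCoord (M : ℕ) {Ω : Type*} (ω : Ω) : (Ω → rootsOfUnity M ℂ) →* ℂˣ :=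
  (rootsOfUnity M ℂ).subtype.comp (Pi.evalMonoidHom _ ω)

theorem mat_torusAct {M : ℕ} [NeZero M] (t : (Σ k, Fin (D k)) → rootsOfUnity M ℂ) (y : Fam n D)
    (k : κ) (γ : LinkGroup n) (i j : Fin (D k)) : (torusAct t y k).mat γ i j =
      (((torusCoord M (⟨k, i⟩ : Σ k, Fin (D k)) /
        torusCoord M (⟨k, j⟩ : Σ k, Fin (D k))) t : ℂˣ) : ℂ) *
        (y k).mat γ i j := by
  rw [torusAct, Fam.conj, Rep.mat_conj]
  simp only [unitaryDiagonal, Matrix.diagonal_conjTranspose, Matrix.mul_diagonal,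
    Matrix.diagonal_mul, Pi.star_apply]
  rw [Complex.star_def, Complex.conj_rootsOfUnity (t ⟨k, j⟩).2]
  simp [torusCoord, MonoidHom.div_apply, div_eq_mul_inv]
  ring

/-- A matrix entry as a `MatEntry`. -/
def toMatEntry (q : Σ k : κ, LinkGroup n × Fin (D k) × Fin (D k)) : MatEntry n D :=
  ⟨q.1, fun y => (y q.1).mat q.2.1, q.2.2⟩

theorem prod_val_torusAct {M : ℕ} [NeZero M] (t : (Σ k, Fin (D k)) → rootsOfUnity M ℂ)
    (y : Fam n D) (L : List (Σ k : κ, LinkGroup n × Fin (D k) × Fin (D k))) :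
    ((L.map toMatEntry).map MatEntry.val).prod (torusAct t y) =
      ((((L.map toMatEntry).map fun q => torusCoord M q.src / torusCoord M q.tgt).prod t : ℂˣ) : ℂ) *
        ((L.map toMatEntry).map MatEntry.val).prod y := by
  induction L with
  | nil => simp
  | cons q L ih =>
    simp only [List.map_cons, List.prod_cons, Pi.mul_apply, ih, MonoidHom.mul_apply, Units.val_mul]
    have h : (toMatEntry q).val (torusAct t y) =
        (((torusCoord M (toMatEntry q).src / torusCoord M (toMatEntry q).tgt) t : ℂˣ) : ℂ) *
          (toMatEntry q).val y := mat_torusAct t y q.1 q.2.1 q.2.2.1 q.2.2.2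
    rw [h]
    ring

theorem prod_map_ite_eq_pow_count {Ω M : Type*} [DecidableEq Ω] [CommMonoid M] (ω : Ω) (ζ : M)
    (L : List Ω) : (L.map fun x => if x = ω then ζ else 1).prod = ζ ^ L.count ω := by
  induction L with
  | nil => simp
  | cons x L ih =>
    rw [List.map_cons, List.prod_cons, ih, List.count_cons]
    by_cases h : x = ω
    · simp [h, pow_succ, mul_comm]
    · simp [h]

/-- A torus character that is trivial on roots of unity of large order is balanced. -/
theorem perm_of_prod_torusCoord_eq_one {M : ℕ} [NeZero M] {L : List (MatEntry n D)}
    (hM : L.length < M)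
    (h : (L.map fun q => torusCoord M q.src / torusCoord M q.tgt).prod = 1) :
    (L.map MatEntry.src).Perm (L.map MatEntry.tgt) := by
  classical
  rw [List.perm_iff_count]
  intro ω
  have hζ := Complex.isPrimitiveRoot_exp M (NeZero.ne M)
  let ζ := hζ.toRootsOfUnity
  -- At this point the character is `ζ` to the difference of the two multiplicities of `ω`; both are
  -- below `M`, so primitivity of `ζ` makes them equal.
  let t : (Σ k, Fin (D k)) → rootsOfUnity M ℂ := fun x => if x = ω then ζ else 1
  have h1 : ∀ K : List (MatEntry n D),
      (K.map fun q => torusCoord M q.src / torusCoord M q.tgt).prod t =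
        ((K.map MatEntry.src).map (torusCoord M)).prod t /
          ((K.map MatEntry.tgt).map (torusCoord M)).prod t := by
    intro K
    induction K with
    | nil => simp
    | cons q K ih =>
      simp only [List.map_cons, List.prod_cons, MonoidHom.mul_apply, MonoidHom.div_apply, ih]
      rw [div_mul_div_comm]
  have h0 := h1 L
  rw [h, MonoidHom.one_apply, eq_comm, div_eq_one] at h0
  have h2 : ∀ K : List (Σ k, Fin (D k)),
      (((K.map (torusCoord M)).prod t : ℂˣ) : ℂ) =
        Complex.exp (2 * Real.pi * Complex.I / M) ^ K.count ω := by
    intro K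
    rw [← prod_map_ite_eq_pow_count]
    induction K with
    | nil => simp
    | cons x K ih =>
      rw [List.map_cons, List.prod_cons, List.map_cons, List.prod_cons, MonoidHom.mul_apply,
        Units.val_mul, ih]
      congr 1
      by_cases hx : x = ω
      · simp [torusCoord, t, hx, ζ]
      · simp [torusCoord, t, hx]
  have h3 := h2 (L.map MatEntry.src)
  rw [h0, h2 (L.map MatEntry.tgt)] at h3
  refine (hζ.pow_inj ?_ ?_ h3).symm <;>
    exact List.count_le_length.trans_lt (by simpa using hM)

/-- A monomial in the entries is scaled by a character of the finite torus, so its average vanishes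
unless the character is trivial; then the monomial is balanced. The bound `M₀` is the length of the
monomials, and allowing every larger `M` lets numerator and denominator share one torus. -/
theorem sum_torusAct_mem {e : κ → MonoidAlgebra ℂ (LinkGroup n)} {U : Set (Fam n D)}
    {z₀ : Fam n D} [Fintype κ] [DecidableEq κ] (hz : z₀ ∈ U)
    (hU : ∀ y ∈ U, ∀ k, ((y k).alg (e k)).IsDiag)
    (hinj : ∀ k, Function.Injective fun i => eig e k i z₀) {f : Fam n D → ℂ}
    (hf : f ∈ entryAlg n D) : ∃ M₀, ∀ (M : ℕ) [NeZero M] [Fintype (rootsOfUnity M ℂ)], M₀ < M →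
      (fun y => ∑ t : (Σ k, Fin (D k)) → rootsOfUnity M ℂ, f (torusAct t y)) ∈
        fracAt (eigAlg D e) U z₀ := by
  set B := fracAt (eigAlg D e) U z₀ with hB
  have hf' : f ∈ Submodule.span ℂ (Submonoid.closure
      {f : Fam n D → ℂ | ∃ k γ i j, f = entry k γ i j} : Set (Fam n D → ℂ)) := by
    rw [← Algebra.adjoin_eq_span]
    exact hf
  clear hf
  induction hf' using Submodule.span_induction with
  | mem f hf =>
    have hL : ∃ L : List (Σ k : κ, LinkGroup n × Fin (D k) × Fin (D k)),
        f = ((L.map toMatEntry).map MatEntry.val).prod := by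
      induction hf using Submonoid.closure_induction with
      | mem f hf =>
        obtain ⟨k, γ, i, j, rfl⟩ := hf
        exact ⟨[⟨k, γ, i, j⟩], by simp; rfl⟩
      | one => exact ⟨[], rfl⟩
      | mul f g _ _ hf hg =>
        obtain ⟨L, rfl⟩ := hf
        obtain ⟨L', rfl⟩ := hg
        exact ⟨L ++ L', by simp⟩
    obtain ⟨L, rfl⟩ := hL
    refine ⟨L.length, fun M _ _ hM => ?_⟩
    simp_rw [prod_val_torusAct, ← Finset.sum_mul]
    set χ := ((L.map toMatEntry).map fun q => torusCoord M q.src / torusCoord M q.tgt).prod with hχ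
    by_cases h1 : χ = 1
    · refine mul_mem (B.algebraMap_mem _) (prod_val_mem_fracAt hz hU hinj _ ?_
        (perm_of_prod_torusCoord_eq_one (by simpa using hM) h1))
      intro q hq
      obtain ⟨x, _, rfl⟩ := List.mem_map.1 hq
      simpa using! smul_mat_mem_matFun (k := x.1) B.one_mem x.2.1
    · have h2 := sum_hom_units_eq_zero ((Units.coeHom ℂ).comp χ) (fun h => h1 (MonoidHom.ext
        fun t => Units.ext (DFunLike.congr_fun h t)))
      have h3 : ∑ t, ((χ t : ℂˣ) : ℂ) = 0 := h2
      simp only [h3, zero_mul]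
      exact B.zero_mem
  | zero =>
    refine ⟨0, fun M _ _ _ => ?_⟩
    simp only [Pi.zero_apply, Finset.sum_const_zero]
    exact B.zero_mem
  | add f g _ _ hf hg =>
    obtain ⟨M₁, h₁⟩ := hf
    obtain ⟨M₂, h₂⟩ := hg
    refine ⟨max M₁ M₂, fun M _ _ hM => ?_⟩
    simp only [Pi.add_apply, Finset.sum_add_distrib]
    exact add_mem (h₁ M (lt_of_le_of_lt (le_max_left _ _) hM))
      (h₂ M (lt_of_le_of_lt (le_max_right _ _) hM))
  | smul c f _ hf =>
    obtain ⟨M₁, h₁⟩ := hf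
    refine ⟨M₁, fun M _ _ hM => ?_⟩
    simp only [Pi.smul_apply, ← Finset.smul_sum]
    exact B.smul_mem (h₁ M hM) c

end TwistedHopf

namespace TwistedHopf

open Matrix

variable {n : ℕ} {κ : Type*} {D : κ → ℕ}

/-! ### The symmetric groups -/

/-- A unitary permutation matrix. -/
def unitaryPerm {m : ℕ} (σ : Equiv.Perm (Fin m)) : Matrix.unitaryGroup (Fin m) ℂ :=
  ⟨σ.toPEquiv.toMatrix, by
    rw [Matrix.mem_unitaryGroup_iff, Matrix.star_eq_conjTranspose]
    have h := conjTranspose_permMatrix (R := ℂ) σ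
    rw [Equiv.Perm.permMatrix] at h
    rw [h, Equiv.Perm.permMatrix, ← PEquiv.toMatrix_trans, ← Equiv.toPEquiv_trans]
    have : σ.trans σ⁻¹ = Equiv.refl _ := by ext; simp
    rw [this, Equiv.toPEquiv_refl, PEquiv.toMatrix_refl]⟩

theorem unitaryPerm_conj {m : ℕ} (σ : Equiv.Perm (Fin m)) (X : Matrix (Fin m) (Fin m) ℂ) :
    (unitaryPerm σ).1 * X * (unitaryPerm σ).1ᴴ = X.submatrix σ σ := by
  have h := conjTranspose_permMatrix (R := ℂ) σ
  rw [Equiv.Perm.permMatrix] at h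
  rw [unitaryPerm, h, Equiv.Perm.permMatrix, PEquiv.toMatrix_toPEquiv_mul,
    PEquiv.mul_toMatrix_toPEquiv]
  rfl

theorem unitaryPerm_one {m : ℕ} : unitaryPerm (1 : Equiv.Perm (Fin m)) = 1 := by
  apply Subtype.ext
  change (Equiv.refl (Fin m)).toPEquiv.toMatrix = (1 : Matrix (Fin m) (Fin m) ℂ)
  rw [Equiv.toPEquiv_refl, PEquiv.toMatrix_refl]

/-- The action of a product of symmetric groups by permutation matrices. -/
def permAct (τ : ∀ k, Equiv.Perm (Fin (D k))) (y : Fam n D) : Fam n D :=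
  y.conj fun k => unitaryPerm (τ k)

theorem eig_permAct (e : κ → MonoidAlgebra ℂ (LinkGroup n)) (τ : ∀ k, Equiv.Perm (Fin (D k)))
    (k : κ) (i : Fin (D k)) (y : Fam n D) : eig e k i (permAct τ y) = eig e k (τ k i) y := by
  rw [eig, permAct, Fam.conj, Rep.alg_conj, unitaryPerm_conj]
  rfl

/-- Permutation matrices fix the characters and permute the eigenvalues of `e k`. Symmetric
functions of the eigenvalues are polynomials in power sums, which on the slice are the traces of
powers of `e k`. -/
theorem sum_permAct_mem [Fintype κ] [DecidableEq κ] {e : κ → MonoidAlgebra ℂ (LinkGroup n)}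
    {U : Set (Fam n D)} {z₀ : Fam n D}
    (hU : ∀ y ∈ U, ∀ k, ((y k).alg (e k)).IsDiag) {f : Fam n D → ℂ} (hf : f ∈ eigAlg D e) :
    (fun y => ∑ τ : ∀ k, Equiv.Perm (Fin (D k)), f (permAct τ y)) ∈
      fracAt (famCharAlg n D) U z₀ := by
  set B := fracAt (famCharAlg n D) U z₀ with hB
  let N : Submonoid (Fam n D → ℂ) :=
    { carrier := {f | ∃ c ∈ famCharAlg n D, ∃ m : ∀ k, Fin (D k) → ℕ,
        f = c * ∏ k, ∏ i, eig e k i ^ m k i}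
      one_mem' := ⟨1, one_mem _, 0, by simp⟩
      mul_mem' := by
        rintro _ _ ⟨c, hc, m, rfl⟩ ⟨c', hc', m', rfl⟩
        refine ⟨c * c', mul_mem hc hc', m + m', ?_⟩
        simp only [Pi.add_apply, pow_add, Finset.prod_mul_distrib]
        ring }
  have hle : Submonoid.closure ({f : Fam n D → ℂ | ∃ k γ, f = famChar k γ} ∪
      {f | ∃ k i, f = eig e k i}) ≤ N := by
    refine Submonoid.closure_le.2 ?_
    rintro _ (⟨k, γ, rfl⟩ | ⟨k, i, rfl⟩)
    · exact ⟨_, Algebra.subset_adjoin ⟨k, γ, rfl⟩, 0, by simp⟩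
    · refine ⟨1, one_mem _, Pi.single k (Pi.single i 1), ?_⟩
      rw [one_mul, Finset.prod_eq_single k, Finset.prod_eq_single i]
      · simp
      · intro j _ hj
        simp [hj]
      · simp
      · intro j _ hj
        simp [hj]
      · simp
  have hf' : f ∈ Submodule.span ℂ (N : Set (Fam n D → ℂ)) := by
    refine Submodule.span_mono hle ?_
    rw [← Algebra.adjoin_eq_span]
    exact hf
  clear hf
  induction hf' using Submodule.span_induction with
  | mem f hf =>
    obtain ⟨c, hc, m, rfl⟩ := hf
    have h1 : (fun y => ∑ τ : ∀ k, Equiv.Perm (Fin (D k)),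
        (c * ∏ k, ∏ i, eig e k i ^ m k i) (permAct τ y)) =
        c * ∏ k, ∑ σ : Equiv.Perm (Fin (D k)), ∏ i, eig e k (σ i) ^ m k i := by
      rw [← sum_pi_perm_prod D fun k i j => eig (n := n) e k j ^ m k i]
      ext y
      simp only [Pi.mul_apply, Finset.prod_apply, Finset.sum_apply, Pi.pow_apply, eig_permAct,
        Finset.mul_sum]
      refine Finset.sum_congr rfl fun τ _ => ?_
      rw [permAct, famCharAlg_conj hc]
    rw [h1]
    refine mul_mem (le_fracAt hc) (prod_mem fun k _ => ?_)
    refine sum_perm_prod_mem B {F | ∃ p : ℕ, F = fun i => eig e k i ^ p} ?_ ?_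
      (fun i j => eig e k j ^ m k i) fun i => ⟨m k i, rfl⟩
    · rintro _ ⟨p, rfl⟩ _ ⟨q, rfl⟩
      exact ⟨p + q, by ext1 i; simp [pow_add]⟩
    · rintro _ ⟨p, rfl⟩
      refine fracAt_of_eqOn (trace_alg_mem_famCharAlg k (e k ^ p)) fun y hy => ?_
      rw [map_pow, ← (hU y hy k).diagonal_diag, Matrix.diagonal_pow, Matrix.trace_diagonal,
        Finset.sum_apply]
      rfl
  | zero =>
    simp only [Pi.zero_apply, Finset.sum_const_zero]
    exact B.zero_mem
  | add f g _ _ hf hg =>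
    simp only [Pi.add_apply, Finset.sum_add_distrib]
    exact add_mem hf hg
  | smul c f _ hf =>
    simp only [Pi.smul_apply, ← Finset.smul_sum]
    exact B.smul_mem hf c

/-! ### Invariant local fractions of entries are local fractions of characters -/

theorem exists_conj_isDiag {m : ℕ} {ρ : Rep n m} {x : MonoidAlgebra ℂ (LinkGroup n)}
    (h : (ρ.alg x).IsHermitian) : ∃ g, ((ρ.conj g).alg x).IsDiag := by
  have h1 := h.spectral_theorem
  rw [Unitary.conjStarAlgAut_apply] at h1
  generalize h.eigenvectorUnitary = V at h1
  have h2 : V.1ᴴ * V.1 = 1 := Matrix.mem_unitaryGroup_iff'.1 V.2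
  refine ⟨V⁻¹, ?_⟩
  have h3 : (V⁻¹).1 = V.1ᴴ := rfl
  rw [Matrix.star_eq_conjTranspose] at h1
  rw [Rep.alg_conj, h3, Matrix.conjTranspose_conjTranspose, h1, Matrix.mul_assoc, Matrix.mul_assoc,
    Matrix.mul_assoc, h2, Matrix.mul_one, ← Matrix.mul_assoc, h2, Matrix.one_mul]
  exact Matrix.isDiag_diagonal _

theorem exists_separating {m : ℕ} {ρ : Rep n m} (h : ρ.Spans) :
    ∃ e : MonoidAlgebra ℂ (LinkGroup n), (∀ σ : Rep n m, (σ.alg e).IsHermitian) ∧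
      ρ.alg e = diagonal fun i : Fin m => ((i : ℕ) : ℂ) := by
  -- The half is made up by adding the adjoint, which ensures Hermitian values in every
  -- representation.
  obtain ⟨x, hx⟩ := h.alg_surjective (diagonal fun i : Fin m => ((i : ℕ) : ℂ) / 2)
  obtain ⟨x', hx'⟩ := exists_alg_eq_conjTranspose x
  refine ⟨x + x', fun σ => ?_, ?_⟩
  · rw [map_add, hx', Matrix.IsHermitian, Matrix.conjTranspose_add,
      Matrix.conjTranspose_conjTranspose, add_comm]
  · rw [map_add, hx', hx, Matrix.diagonal_conjTranspose, Matrix.diagonal_add]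
    congr 1
    ext i
    simp

/-- The slice `U'` consists of the families on which all `e k` are diagonal. Its residual
symmetries, diagonal and permutation matrices, suffice to average entries down to characters. -/
theorem mem_fracAt_famCharAlg [Fintype κ] {U : Set (Fam n D)} {z₀ : Fam n D} (hz : z₀ ∈ U)
    (hU : ∀ g, ∀ y ∈ U, Fam.conj g y ∈ U) (hspan : ∀ k, (z₀ k).Spans) {F : Fam n D → ℂ}
    (hF : ∀ g, ∀ y ∈ U, F (y.conj g) = F y) (h : F ∈ fracAt (entryAlg n D) U z₀) :
    F ∈ fracAt (famCharAlg n D) U z₀ := by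
  classical
  choose e he he₀ using fun k => exists_separating (hspan k)
  let U' : Set (Fam n D) := {y | y ∈ U ∧ ∀ k, ((y k).alg (e k)).IsDiag}
  have hU'U : U' ⊆ U := fun y hy => hy.1
  have hz' : z₀ ∈ U' := ⟨hz, fun k => by rw [he₀]; exact Matrix.isDiag_diagonal _⟩
  have hdiag : ∀ y ∈ U', ∀ k, ((y k).alg (e k)).IsDiag := fun y hy => hy.2
  have hinj : ∀ k, Function.Injective fun i => eig e k i z₀ := by
    intro k i j hij
    simp only [eig, he₀, Matrix.diagonal_apply_eq, Nat.cast_inj] at hij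
    exact Fin.ext hij
  have h1 : F ∈ fracAt (eigAlg D e) U' z₀ := by
    obtain ⟨P, hP, Q, hQ, h0, H⟩ := fracAt_anti hU'U h
    obtain ⟨M₁, h₁⟩ := sum_torusAct_mem hz' hdiag hinj (mul_mem hP (star_mem_entryAlg hQ))
    obtain ⟨M₂, h₂⟩ := sum_torusAct_mem hz' hdiag hinj (mul_mem hQ (star_mem_entryAlg hQ))
    let M := M₁ + M₂ + 1
    have : NeZero M := ⟨Nat.succ_ne_zero _⟩
    let _ : Fintype (rootsOfUnity M ℂ) := Fintype.ofFinite _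
    refine fracAt_of_average hz' (fun t : (Σ k, Fin (D k)) → rootsOfUnity M ℂ => torusAct t)
      ?_ 1 ?_ (h₁ M (by omega)) (h₂ M (by omega)) (fun t y hy => hF _ y hy.1) h0 H
    · intro t y hy
      refine ⟨hU _ y hy.1, fun k i j hij => ?_⟩
      have h3 := hy.2 k hij
      rw [torusAct, Fam.conj, Rep.alg_conj]
      simp only [unitaryDiagonal, Matrix.diagonal_conjTranspose, Matrix.mul_diagonal,
        Matrix.diagonal_mul]
      rw [h3]
      simp
    · ext1 k
      rw [torusAct, Fam.conj]
      convert Rep.conj_one (z₀ k)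
      apply Subtype.ext
      simp [unitaryDiagonal]
  have h2 : F ∈ fracAt (famCharAlg n D) U' z₀ := by
    obtain ⟨P, hP, Q, hQ, h0, H⟩ := h1
    refine fracAt_of_average hz' (fun τ : ∀ k, Equiv.Perm (Fin (D k)) => permAct τ)
      ?_ 1 ?_ (sum_permAct_mem hdiag (mul_mem hP (star_mem_eigAlg he hQ)))
      (sum_permAct_mem hdiag (mul_mem hQ (star_mem_eigAlg he hQ)))
      (fun t y hy => hF _ y hy.1) h0 H
    · intro τ y hy
      refine ⟨hU _ y hy.1, fun k i j hij => ?_⟩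
      rw [permAct, Fam.conj, Rep.alg_conj, unitaryPerm_conj]
      exact hy.2 k fun h => hij ((τ k).injective h)
    · ext1 k
      rw [permAct, Fam.conj, Pi.one_apply, unitaryPerm_one, Rep.conj_one]
  obtain ⟨P, hP, Q, hQ, h0, H⟩ := h2
  refine ⟨P, hP, Q, hQ, h0, fun y hy => ?_⟩
  -- By the spectral theorem every family in `U` is conjugate into the slice, and `P`, `Q`, `F` are
  -- all invariant.
  choose g hg using fun k => exists_conj_isDiag (he k (y k))
  have h3 := H (y.conj g) ⟨hU g y hy, hg⟩
  rwa [famCharAlg_conj hP, famCharAlg_conj hQ, hF g y hy] at h3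

end TwistedHopf

namespace TwistedHopf

open Matrix

variable {n r s : ℕ} {d a : Fin s → ℕ}

/-! ### Direct sums -/

theorem mat_directSum {κ : Type} [Fintype κ] [DecidableEq κ] {m : κ → ℕ}
    (e : (Σ k, Fin (m k)) ≃ Fin r) (ρ : ∀ k, Rep n (m k)) (γ : LinkGroup n) :
    (directSum e ρ).mat γ =
      (Matrix.blockDiagonal' fun k => (ρ k).mat γ).submatrix e.symm e.symm := rfl

theorem chi_directSum {κ : Type} [Fintype κ] [DecidableEq κ] {m : κ → ℕ}
    (e : (Σ k, Fin (m k)) ≃ Fin r) (ρ : ∀ k, Rep n (m k)) (γ : LinkGroup n) :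
    chi γ ⟨r, directSum e ρ⟩ = ∑ k, chi γ ⟨m k, ρ k⟩ := by
  simp only [chi]
  rw [mat_directSum, ← Matrix.trace_blockDiagonal']
  exact Equiv.sum_comp e.symm fun x => (Matrix.blockDiagonal' fun k => (ρ k).mat γ) x x

theorem cls_eq_iff {ρ σ : Rep n r} : ρ.cls = σ.cls ↔ ∃ g, σ = ρ.conj g := by
  refine ⟨fun h => ?_, ?_⟩
  · obtain ⟨g, hg⟩ := Quotient.exact h
    exact ⟨g, MonoidHom.ext hg⟩
  · rintro ⟨g, rfl⟩
    exact Quotient.sound ⟨g, fun γ => rfl⟩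

theorem chi_eq_of_cls_eq {ρ σ : Rep n r} (h : ρ.cls = σ.cls) (γ : LinkGroup n) :
    chi γ ⟨r, ρ⟩ = chi γ ⟨r, σ⟩ := by
  obtain ⟨g, rfl⟩ := cls_eq_iff.1 h
  exact (Rep.chi_conj g ρ γ).symm

/-- The block diagonal unitary matrix. -/
def unitaryBlock {κ : Type} [Fintype κ] [DecidableEq κ] {m : κ → ℕ}
    (e : (Σ k, Fin (m k)) ≃ Fin r) (g : ∀ k, Matrix.unitaryGroup (Fin (m k)) ℂ) :
    Matrix.unitaryGroup (Fin r) ℂ :=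
  ⟨(Matrix.blockDiagonal' fun k => (g k).1).submatrix e.symm e.symm, by
    rw [Matrix.mem_unitaryGroup_iff, Matrix.star_eq_conjTranspose, Matrix.conjTranspose_submatrix,
      Matrix.blockDiagonal'_conjTranspose, Matrix.submatrix_mul_equiv, ← Matrix.blockDiagonal'_mul]
    have h : (fun k => (g k).1 * (g k).1ᴴ) = 1 := by
      funext k
      exact Matrix.mem_unitaryGroup_iff.1 (g k).2
    rw [h, Matrix.blockDiagonal'_one, Matrix.submatrix_one_equiv]⟩

theorem directSum_conj {κ : Type} [Fintype κ] [DecidableEq κ] {m : κ → ℕ}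
    (e : (Σ k, Fin (m k)) ≃ Fin r) (g : ∀ k, Matrix.unitaryGroup (Fin (m k)) ℂ)
    (ρ : ∀ k, Rep n (m k)) :
    directSum e (fun k => (ρ k).conj (g k)) = (directSum e ρ).conj (unitaryBlock e g) := by
  refine Rep.ext_mat fun γ => ?_
  rw [Rep.mat_conj, mat_directSum, mat_directSum]
  simp only [unitaryBlock, Matrix.conjTranspose_submatrix, Matrix.blockDiagonal'_conjTranspose,
    Matrix.submatrix_mul_equiv, ← Matrix.blockDiagonal'_mul]
  rfl

/-- The permutation of the members of a family. -/
def Tup.perm (g : ∀ i, Equiv.Perm (Fin (a i))) (y : Tup n d a) : Tup n d a :=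
  fun p => y ⟨p.1, g p.1 p.2⟩

/-- Reordering the summands and renumbering the basis together amount to one conjugation by a
permutation matrix. -/
theorem cls_directSum_perm (e e' : (Σ p : (Σ i, Fin (a i)), Fin (d p.1)) ≃ Fin r)
    (g : ∀ i, Equiv.Perm (Fin (a i))) (y : Tup n d a) :
    (directSum e (y.perm g)).cls = (directSum e' y).cls := by
  let T : (Σ p : (Σ i, Fin (a i)), Fin (d p.1)) ≃ (Σ p : (Σ i, Fin (a i)), Fin (d p.1)) :=
    { toFun := fun x => ⟨⟨x.1.1, g x.1.1 x.1.2⟩, x.2⟩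
      invFun := fun x => ⟨⟨x.1.1, (g x.1.1).symm x.1.2⟩, x.2⟩
      left_inv := by rintro ⟨⟨i, l⟩, x⟩; simp
      right_inv := by rintro ⟨⟨i, l⟩, x⟩; simp }
  refine (cls_eq_iff.2 ⟨unitaryPerm ((e.symm.trans T).trans e'), ?_⟩).symm
  refine Rep.ext_mat fun γ => ?_
  rw [Rep.mat_conj, unitaryPerm_conj, mat_directSum, mat_directSum, Matrix.submatrix_submatrix]
  have h : ∀ x x', (Matrix.blockDiagonal' fun p => (y.perm g p).mat γ) x x' =
      (Matrix.blockDiagonal' fun p => (y p).mat γ) (T x) (T x') := by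
    rintro ⟨⟨i, l⟩, x⟩ ⟨⟨i', l'⟩, x'⟩
    by_cases hp : (⟨i, l⟩ : Σ i, Fin (a i)) = ⟨i', l'⟩
    · obtain ⟨rfl, hl⟩ := Sigma.mk.inj hp
      obtain rfl := eq_of_heq hl
      rw [Matrix.blockDiagonal'_apply_eq]
      exact (Matrix.blockDiagonal'_apply_eq (fun p => (y p).mat γ) ⟨i, g i l⟩ x x').symm
    · rw [Matrix.blockDiagonal'_apply_ne _ _ _ hp]
      refine (Matrix.blockDiagonal'_apply_ne (fun p => (y p).mat γ) _ _ ?_).symm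
      intro h
      obtain ⟨rfl, hl⟩ := Sigma.mk.inj h
      exact hp (congrArg (Sigma.mk i) ((g i).injective (eq_of_heq hl)))
  ext j k
  rw [Matrix.submatrix_apply, h]
  simp

/-! ### The two quotient maps -/

/-- Families of irreducible representations. -/
abbrev IrrTup (n : ℕ) {s : ℕ} (d a : Fin s → ℕ) : Type :=
  ∀ p : (Σ i, Fin (a i)), {ρ : Rep n (d p.1) // ρ.IsIrreducible}

/-- The underlying family. -/
def IrrTup.tup (y : IrrTup n d a) : Tup n d a := fun p => (y p).1

theorem IrrTup.spans (y : IrrTup n d a) (p : Σ i, Fin (a i)) : (y.tup p).Spans := (y p).2.spans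

/-- The family of unordered collections of classes. -/
def symClass (y : IrrTup n d a) (i : Fin s) : SymProd (irrLocus n (d i)) (a i) :=
  Quotient.mk _ fun l => irrCls (y ⟨i, l⟩).1 (y ⟨i, l⟩).2

/-- The class of the direct sum. -/
def sumClass (e : (Σ p : (Σ i, Fin (a i)), Fin (d p.1)) ≃ Fin r) (y : IrrTup n d a) :
    stratum n r d a :=
  ⟨(directSum e y.tup).cls, y.tup, fun p => (y p).2, e, rfl⟩

theorem symClass_eq_iff {y y' : IrrTup n d a} : symClass y = symClass y' ↔
    ∃ g : ∀ i, Equiv.Perm (Fin (a i)), ∀ p, (y.tup.perm g p).cls = (y'.tup p).cls := by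
  refine ⟨fun h => ?_, ?_⟩
  · have h1 : ∀ i, ∃ σ : Equiv.Perm (Fin (a i)), ∀ l,
        (y.tup ⟨i, σ l⟩).cls = (y'.tup ⟨i, l⟩).cls := by
      intro i
      obtain ⟨σ, hσ⟩ := Quotient.exact (congrFun h i)
      exact ⟨σ, fun l => (Subtype.ext_iff.1 (congrFun hσ l)).symm⟩
    choose g hg using h1
    exact ⟨g, fun p => hg p.1 p.2⟩
  · rintro ⟨g, hg⟩
    ext1 i
    refine Quotient.sound ⟨g i, ?_⟩
    ext1 l
    exact Subtype.ext (hg ⟨i, l⟩).symm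

theorem cls_directSum_eq_of_symClass_eq
    (e e' : (Σ p : (Σ i, Fin (a i)), Fin (d p.1)) ≃ Fin r) {y y' : IrrTup n d a}
    (h : symClass y = symClass y') : (directSum e y.tup).cls = (directSum e' y'.tup).cls := by
  obtain ⟨g, hg⟩ := symClass_eq_iff.1 h
  choose u hu using fun p => cls_eq_iff.1 (hg p)
  have h1 : y'.tup = fun p => (y.tup.perm g p).conj (u p) := funext hu
  rw [h1, directSum_conj, ← cls_directSum_perm e' e g]
  exact cls_eq_iff.2 ⟨_, rfl⟩

theorem total_eq_of_cls_eq (e : (Σ p : (Σ i, Fin (a i)), Fin (d p.1)) ≃ Fin r) {y y' : Tup n d a}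
    (h : (directSum e y).cls = (directSum e y').cls) (γ : LinkGroup n) : total γ y = total γ y' := by
  have := chi_eq_of_cls_eq h γ
  rwa [chi_directSum, chi_directSum] at this

theorem symClass_eq_of_sumClass_eq (hd : StrictAnti d) (hpos : ∀ i, 0 < d i)
    (e : (Σ p : (Σ i, Fin (a i)), Fin (d p.1)) ≃ Fin r) {y y' : IrrTup n d a}
    (h : sumClass e y = sumClass e y') : symClass y = symClass y' := by
  have ht := total_eq_of_cls_eq e (Subtype.ext_iff.1 h)
  have hp := exists_perm_of_total_eq hd hpos y'.spans ht
  choose g hg using hp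
  refine symClass_eq_iff.2 ⟨g, fun p => Eq.symm ?_⟩
  obtain ⟨u, hu⟩ := exists_conj_of_chi_eq (hpos p.1) (y'.spans p) fun γ => (hg p.1 p.2 γ).symm
  exact cls_eq_iff.2 ⟨u, MonoidHom.ext hu⟩

theorem symClass_surjective : Function.Surjective (symClass (n := n) (d := d) (a := a)) := by
  intro z
  choose f hf using fun i => Quotient.exists_rep (z i)
  choose ρ hρ using fun p : (Σ i, Fin (a i)) => (f p.1 p.2).2
  refine ⟨fun p => ⟨ρ p, (hρ p).1⟩, ?_⟩
  ext1 i
  rw [← hf i, symClass]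
  congr 1
  ext1 l
  exact Subtype.ext (hρ ⟨i, l⟩).2

theorem sumClass_surjective (e : (Σ p : (Σ i, Fin (a i)), Fin (d p.1)) ≃ Fin r) :
    Function.Surjective (sumClass (n := n) e) := by
  rintro ⟨x, ρ, hρ, e', rfl⟩
  refine ⟨fun p => ⟨ρ p, hρ p⟩, Subtype.ext ?_⟩
  exact cls_directSum_eq_of_symClass_eq (y := fun p => ⟨ρ p, hρ p⟩)
    (y' := fun p => ⟨ρ p, hρ p⟩) e e' rfl

theorem isIrreducible_of_cls_eq (hd : StrictAnti d) (hpos : ∀ i, 0 < d i)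
    (e : (Σ p : (Σ i, Fin (a i)), Fin (d p.1)) ≃ Fin r) {y : Tup n d a} {y' : IrrTup n d a}
    (h : (directSum e y).cls = (directSum e y'.tup).cls) (p : Σ i, Fin (a i)) :
    (y p).IsIrreducible :=
  (spans_of_total_eq hd hpos y'.spans (total_eq_of_cls_eq e h) p).isIrreducible (hpos p.1)

theorem isIrreducible_conj {m : ℕ} {ρ : Rep n m} (h : ρ.IsIrreducible)
    (g : Matrix.unitaryGroup (Fin m) ℂ) : (ρ.conj g).IsIrreducible :=
  (h.spans.conj g).isIrreducible h.pos

/-- The bijection from the product of symmetric products to the stratum. -/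
noncomputable def strataEquiv (hd : StrictAnti d) (hpos : ∀ i, 0 < d i)
    (e : (Σ p : (Σ i, Fin (a i)), Fin (d p.1)) ≃ Fin r) :
    (∀ i, SymProd (irrLocus n (d i)) (a i)) ≃ stratum n r d a :=
  -- The choice of representatives is harmless by `cls_directSum_eq_of_symClass_eq`.
  Equiv.ofBijective (fun z => sumClass e (Function.surjInv symClass_surjective z)) (by
    constructor
    · intro z z' h
      have := symClass_eq_of_sumClass_eq hd hpos e h
      rwa [Function.surjInv_eq symClass_surjective, Function.surjInv_eq symClass_surjective] at this
    · intro x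
      obtain ⟨y, rfl⟩ := sumClass_surjective e x
      exact ⟨symClass y, Subtype.ext (cls_directSum_eq_of_symClass_eq e e
        (Function.surjInv_eq symClass_surjective _))⟩)

theorem strataEquiv_symClass (hd : StrictAnti d) (hpos : ∀ i, 0 < d i)
    (e : (Σ p : (Σ i, Fin (a i)), Fin (d p.1)) ≃ Fin r) (y : IrrTup n d a) :
    strataEquiv hd hpos e (symClass y) = sumClass e y :=
  Subtype.ext (cls_directSum_eq_of_symClass_eq e e (Function.surjInv_eq symClass_surjective _))

end TwistedHopf

namespace TwistedHopf

open Matrix Topology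

variable {n r s : ℕ} {d a : Fin s → ℕ}

/-! ### Topology -/

instance unitaryGroup_compactSpace (m : ℕ) : CompactSpace (Matrix.unitaryGroup (Fin m) ℂ) := by
  refine isCompact_iff_compactSpace.1 ?_
  have h1 : IsCompact (Set.univ.pi fun _ : Fin m => Set.univ.pi fun _ : Fin m =>
      Metric.closedBall (0 : ℂ) 1) :=
    isCompact_univ_pi fun _ => isCompact_univ_pi fun _ => isCompact_closedBall _ _
  refine h1.of_isClosed_subset ?_ ?_
  · have h2 : ((Matrix.unitaryGroup (Fin m) ℂ : Set (Matrix (Fin m) (Fin m) ℂ))) =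
        {X | X * star X = 1} := by
      ext X
      exact Matrix.mem_unitaryGroup_iff
    change IsClosed (X := Matrix (Fin m) (Fin m) ℂ) _
    rw [h2]
    exact isClosed_eq (by fun_prop) continuous_const
  · intro X hX i _ j _
    simpa using entry_norm_bound_of_unitary hX i j

/-- The pair of matrices of the generators. -/
def genPair (ρ : Rep n r) : Matrix.unitaryGroup (Fin r) ℂ × Matrix.unitaryGroup (Fin r) ℂ :=
  (ρ (gen n 0), ρ (gen n 1))

theorem closure_gen : Subgroup.closure (Set.range (gen n)) = ⊤ := PresentedGroup.closure_range_of _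

theorem genPair_injective : Function.Injective (genPair (n := n) (r := r)) := by
  intro ρ σ h
  refine MonoidHom.eq_of_eqOn_dense closure_gen ?_
  rintro _ ⟨j, rfl⟩
  fin_cases j
  · exact congrArg Prod.fst h
  · exact congrArg Prod.snd h

theorem range_genPair : Set.range (genPair (n := n) (r := r)) =
    {p | p.1 ^ n * p.2 * (p.1 ^ n)⁻¹ * p.2⁻¹ = 1} := by
  ext ⟨A, B⟩
  constructor
  · rintro ⟨ρ, hρ⟩
    obtain ⟨rfl, rfl⟩ := Prod.mk.inj hρ
    have h : gen n 0 ^ n * gen n 1 * (gen n 0 ^ n)⁻¹ * (gen n 1)⁻¹ = 1 :=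
      PresentedGroup.one_of_mem (rels := {relator n}) rfl
    have h1 := congrArg ρ h
    simpa using h1
  · intro h
    have h0 : A ^ n * B * (A ^ n)⁻¹ * B⁻¹ = 1 := h
    have h1 : ∀ w ∈ ({relator n} : Set (FreeGroup (Fin 2))),
        FreeGroup.lift (![A, B] : Fin 2 → Matrix.unitaryGroup (Fin r) ℂ) w = 1 := by
      rintro _ rfl
      simpa [relator] using h0
    refine ⟨PresentedGroup.toGroup h1, ?_⟩
    ext1
    · exact PresentedGroup.toGroup.of h1
    · exact PresentedGroup.toGroup.of h1

theorem isClosedEmbedding_genPair : IsClosedEmbedding (genPair (n := n) (r := r)) := by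
  refine ⟨⟨⟨rfl⟩, genPair_injective⟩, ?_⟩
  rw [range_genPair]
  exact isClosed_eq (by fun_prop) continuous_const

instance rep_compactSpace : CompactSpace (Rep n r) := isClosedEmbedding_genPair.compactSpace

instance rep_t2Space : T2Space (Rep n r) := isClosedEmbedding_genPair.isEmbedding.t2Space

theorem continuous_rep_iff {X : Type*} [TopologicalSpace X] {f : X → Rep n r} :
    Continuous f ↔ ∀ j, Continuous fun x => (f x).mat (gen n j) := by
  rw [isClosedEmbedding_genPair.isInducing.continuous_iff, Fin.forall_fin_two]
  constructor
  · intro h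
    exact ⟨continuous_subtype_val.comp (continuous_fst.comp h),
      continuous_subtype_val.comp (continuous_snd.comp h)⟩
  · rintro ⟨h1, h2⟩
    exact (Continuous.subtype_mk h1 _).prodMk (Continuous.subtype_mk h2 _)

theorem continuous_mat_gen (j : Fin 2) : Continuous fun ρ : Rep n r => ρ.mat (gen n j) :=
  continuous_rep_iff.1 continuous_id j

theorem continuous_conj : Continuous fun p : Matrix.unitaryGroup (Fin r) ℂ × Rep n r =>
    p.2.conj p.1 := by
  rw [continuous_rep_iff]
  intro j
  simp only [Rep.mat_conj]
  have h1 : Continuous fun p : Matrix.unitaryGroup (Fin r) ℂ × Rep n r => p.1.1 :=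
    continuous_subtype_val.comp continuous_fst
  exact (h1.mul ((continuous_mat_gen j).comp continuous_snd)).mul h1.star

theorem continuous_directSum {κ : Type} [Fintype κ] [DecidableEq κ] {m : κ → ℕ}
    (e : (Σ k, Fin (m k)) ≃ Fin r) :
    Continuous fun ρ : ∀ k, Rep n (m k) => directSum e ρ := by
  rw [continuous_rep_iff]
  intro j
  simp only [mat_directSum]
  refine Continuous.matrix_submatrix (Continuous.matrix_blockDiagonal' ?_) _ _
  exact continuous_pi fun k => (continuous_mat_gen j).comp (continuous_apply k)

/-- Openness is recorded since products of open quotient maps are again quotient maps, whereas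
products of mere quotient maps may fail to be. -/
theorem isOpenQuotientMap_cls : IsOpenQuotientMap (Rep.cls (n := n) (r := r)) := by
  refine ⟨Quotient.mk_surjective, continuous_quotient_mk', fun V hV => ?_⟩
  rw [← isQuotientMap_quotient_mk'.isOpen_preimage]
  have h : (Quotient.mk (conjSetoid n r)) ⁻¹' (Rep.cls '' V) = ⋃ g, (Rep.conj g) ⁻¹' V := by
    ext ρ
    simp only [Set.mem_preimage, Set.mem_image, Set.mem_iUnion]
    constructor
    · rintro ⟨σ, hσ, h⟩
      obtain ⟨g, rfl⟩ := cls_eq_iff.1 (show ρ.cls = σ.cls from h.symm)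
      exact ⟨g, hσ⟩
    · rintro ⟨g, hg⟩
      exact ⟨_, hg, (cls_eq_iff.2 ⟨g, rfl⟩).symm⟩
  change IsOpen ((Quotient.mk (conjSetoid n r)) ⁻¹' (Rep.cls '' V))
  rw [h]
  exact isOpen_iUnion fun g => hV.preimage (continuous_conj.comp (by fun_prop :
    Continuous fun ρ : Rep n r => (g, ρ)))

theorem isOpenQuotientMap_irrCls : IsOpenQuotientMap
    (fun ρ : {ρ : Rep n r // ρ.IsIrreducible} => irrCls ρ.1 ρ.2) := by
  refine ⟨?_, ?_, ?_⟩
  · rintro ⟨x, ρ, hρ, rfl⟩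
    exact ⟨⟨ρ, hρ⟩, rfl⟩
  · exact Continuous.subtype_mk (isOpenQuotientMap_cls.continuous.comp continuous_subtype_val) _
  · intro V hV
    obtain ⟨W, hW, rfl⟩ := isOpen_induced_iff.1 hV
    refine isOpen_induced_iff.2 ⟨Rep.cls '' W, isOpenQuotientMap_cls.isOpenMap W hW, ?_⟩
    ext ⟨x, hx⟩
    simp only [Set.mem_preimage, Set.mem_image]
    constructor
    · rintro ⟨ρ, hρ, rfl⟩
      obtain ⟨σ, hσ, h⟩ := hx
      obtain ⟨g, rfl⟩ := cls_eq_iff.1 h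
      exact ⟨⟨_, isIrreducible_conj hσ g⟩, hρ, rfl⟩
    · rintro ⟨ρ, hρ, h⟩
      exact ⟨ρ.1, hρ, Subtype.ext_iff.1 h⟩

theorem isOpenQuotientMap_symProd_mk (Y : Type*) [TopologicalSpace Y] (k : ℕ) :
    IsOpenQuotientMap (Quotient.mk (permSetoid Y k)) := by
  refine ⟨Quotient.mk_surjective, continuous_quotient_mk', fun V hV => ?_⟩
  rw [← isQuotientMap_quotient_mk'.isOpen_preimage]
  have h : (Quotient.mk (permSetoid Y k)) ⁻¹' (Quotient.mk (permSetoid Y k) '' V) =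
      ⋃ σ : Equiv.Perm (Fin k), (fun f => f ∘ σ) ⁻¹' V := by
    ext f
    simp only [Set.mem_preimage, Set.mem_image, Set.mem_iUnion]
    constructor
    · rintro ⟨g, hg, h⟩
      obtain ⟨σ, rfl⟩ := Quotient.exact h.symm
      exact ⟨σ, hg⟩
    · rintro ⟨σ, hσ⟩
      exact ⟨_, hσ, (Quotient.sound ⟨σ, rfl⟩ : Quotient.mk (permSetoid Y k) f = _).symm⟩
  change IsOpen ((Quotient.mk (permSetoid Y k)) ⁻¹' (Quotient.mk (permSetoid Y k) '' V))
  rw [h]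
  exact isOpen_iUnion fun σ => hV.preimage
    (continuous_pi fun l => continuous_apply (σ l))

theorem isOpenQuotientMap_symClass :
    IsOpenQuotientMap (symClass (n := n) (d := d) (a := a)) := by
  let c : IrrTup n d a ≃ₜ
      ∀ i, Fin (a i) → {ρ : Rep n (d i) // ρ.IsIrreducible} :=
    { toFun := fun y i l => y ⟨i, l⟩
      invFun := fun f p => f p.1 p.2
      left_inv := fun _ => rfl
      right_inv := fun _ => rfl
      continuous_toFun := continuous_pi fun i => continuous_pi fun l => continuous_apply _
      continuous_invFun := continuous_pi fun p =>
        (continuous_apply p.2).comp (continuous_apply p.1) }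
  have h1 : IsOpenQuotientMap (Pi.map fun i => Quotient.mk (permSetoid (irrLocus n (d i)) (a i)) ∘
      Pi.map fun _ : Fin (a i) =>
        fun ρ : {ρ : Rep n (d i) // ρ.IsIrreducible} => irrCls ρ.1 ρ.2) :=
    IsOpenQuotientMap.piMap fun i => (isOpenQuotientMap_symProd_mk _ _).comp
      (IsOpenQuotientMap.piMap fun _ => isOpenQuotientMap_irrCls)
  exact h1.comp c.isOpenQuotientMap

theorem continuous_sumClass (e : (Σ p : (Σ i, Fin (a i)), Fin (d p.1)) ≃ Fin r) :
    Continuous (sumClass (n := n) e) := by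
  refine Continuous.subtype_mk (isOpenQuotientMap_cls.continuous.comp
    ((continuous_directSum e).comp ?_)) _
  exact continuous_pi fun p => continuous_subtype_val.comp (continuous_apply p)

theorem continuous_conj_directSum (e : (Σ p : (Σ i, Fin (a i)), Fin (d p.1)) ≃ Fin r) :
    Continuous fun p : Matrix.unitaryGroup (Fin r) ℂ × Tup n d a =>
      (directSum e p.2).conj p.1 := by
  have h1 : Continuous fun p : Matrix.unitaryGroup (Fin r) ℂ × Tup n d a =>
      (p.1, directSum e p.2) :=
    continuous_fst.prodMk (Continuous.comp (continuous_directSum e) continuous_snd)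
  have h2 := continuous_conj (n := n) (r := r)
  have h3 := h2.comp h1
  exact h3

/-- The preimage in the representation space is the image of the compact set `U(r) × K` under
conjugation of direct sums. -/
theorem isClosed_image_cls_directSum (e : (Σ p : (Σ i, Fin (a i)), Fin (d p.1)) ≃ Fin r)
    {K : Set (Tup n d a)} (hK : IsClosed K) :
    IsClosed ((fun y : Tup n d a => (directSum e y).cls) '' K) := by
  have hK' : IsCompact ((Set.univ : Set (Matrix.unitaryGroup (Fin r) ℂ)) ×ˢ K) :=
    isCompact_univ.prod hK.isCompact
  have hcl := (hK'.image (continuous_conj_directSum e)).isClosed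
  rw [← isOpenQuotientMap_cls.isQuotientMap.isClosed_preimage]
  convert hcl using 1
  ext ρ
  constructor
  · rintro ⟨y, hy, h⟩
    obtain ⟨g, rfl⟩ := cls_eq_iff.1 h
    exact ⟨(g, y), ⟨trivial, hy⟩, rfl⟩
  · rintro ⟨⟨g, y⟩, ⟨_, hy⟩, rfl⟩
    exact ⟨y, hy, cls_eq_iff.2 ⟨g, rfl⟩⟩

theorem isInducing_tup : IsInducing (IrrTup.tup (n := n) (d := d) (a := a)) :=
  IsInducing.piMap fun _ => IsInducing.subtypeVal

/-- Irreducible tuples need not form a closed set, so the preimage of `C` is extended to a closed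
set `K` of all tuples. No new points of the stratum arise: a tuple whose sum lies there is
irreducible by `isIrreducible_of_cls_eq`. -/
theorem isClosed_image_sumClass (hd : StrictAnti d) (hpos : ∀ i, 0 < d i)
    (e : (Σ p : (Σ i, Fin (a i)), Fin (d p.1)) ≃ Fin r)
    {C : Set (∀ i, SymProd (irrLocus n (d i)) (a i))} (hC : IsClosed C) :
    IsClosed (sumClass e '' (symClass (n := n) ⁻¹' C)) := by
  obtain ⟨K, hK, hKC⟩ := isInducing_tup.isClosed_iff.1
    (hC.preimage isOpenQuotientMap_symClass.continuous)
  convert (isClosed_image_cls_directSum e hK).preimage continuous_subtype_val using 1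
  ext x
  constructor
  · rintro ⟨y, hy, rfl⟩
    rw [← hKC] at hy
    exact ⟨y.tup, hy, rfl⟩
  · rintro ⟨y, hy, h⟩
    obtain ⟨y', rfl⟩ := sumClass_surjective e x
    refine ⟨fun p => ⟨y p, isIrreducible_of_cls_eq hd hpos e h p⟩, ?_, Subtype.ext h⟩
    rw [← hKC]
    exact hy

/-- The homeomorphism from the product of symmetric products to the stratum. -/
noncomputable def strataHomeomorph (hd : StrictAnti d) (hpos : ∀ i, 0 < d i)
    (e : (Σ p : (Σ i, Fin (a i)), Fin (d p.1)) ≃ Fin r) :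
    (∀ i, SymProd (irrLocus n (d i)) (a i)) ≃ₜ stratum n r d a :=
  (strataEquiv hd hpos e).toHomeomorphOfContinuousClosed
    (by
      rw [← isOpenQuotientMap_symClass.continuous_comp_iff]
      convert continuous_sumClass (n := n) e using 1
      ext1 y
      exact strataEquiv_symClass hd hpos e y)
    (by
      intro C hC
      convert isClosed_image_sumClass hd hpos e hC using 1
      rw [← Set.image_preimage_eq C (symClass_surjective (n := n)), ← Set.image_comp,
        Set.image_preimage_eq C (symClass_surjective (n := n))]
      refine Set.image_congr fun y _ => strataEquiv_symClass hd hpos e y)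

end TwistedHopf

namespace TwistedHopf

variable {n r s : ℕ} {d a : Fin s → ℕ}

/-! ### Characters are regular functions -/

theorem comp_mem_complexify {Y Z : Type*} {𝒜 : Subalgebra ℝ (Z → ℝ)} {ℬ : Subalgebra ℝ (Y → ℝ)}
    {φ : Y → Z} (h : ∀ f ∈ 𝒜, f ∘ φ ∈ ℬ) {f : Z → ℂ} (hf : f ∈ complexify 𝒜) :
    f ∘ φ ∈ complexify ℬ :=
  ⟨h _ hf.1, h _ hf.2⟩

theorem star_mem_complexify {Y : Type*} {𝒜 : Subalgebra ℝ (Y → ℝ)} {f : Y → ℂ}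
    (hf : f ∈ complexify 𝒜) : star f ∈ complexify 𝒜 :=
  ⟨hf.1, neg_mem hf.2⟩

/-- Inverses cause no denominators: for unitary matrices they are conjugate transposes. -/
theorem mat_mem_complexify {m : ℕ} (γ : LinkGroup n) (k l : Fin m) :
    (fun ρ : Rep n m => ρ.mat γ k l) ∈ complexify (RegularFunctions.algebra (Y := Rep n m)) := by
  have hγ : γ ∈ Subgroup.closure (Set.range (gen n)) := by rw [closure_gen]; trivial
  induction hγ using Subgroup.closure_induction generalizing k l with
  | mem γ hγ =>
    obtain ⟨j, rfl⟩ := hγ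
    exact ⟨le_localFractions (Algebra.subset_adjoin (Or.inl ⟨j, k, l, rfl⟩)),
      le_localFractions (Algebra.subset_adjoin (Or.inr ⟨j, k, l, rfl⟩))⟩
  | one =>
    simp only [map_one]
    exact Subalgebra.algebraMap_mem _ ((1 : Matrix (Fin m) (Fin m) ℂ) k l)
  | mul γ δ _ _ hγ hδ =>
    have h := Subalgebra.sum_mem _ fun i (_ : i ∈ Finset.univ) => mul_mem (hγ k i) (hδ i l)
    convert h using 1
    ext ρ
    simp [Matrix.mul_apply]
  | inv γ _ hγ =>
    convert star_mem_complexify (hγ l k) using 1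
    ext ρ
    simp [Rep.mat_inv]

theorem exists_regular_of_charAlg {φ : RepPt n → ℂ} (hφ : φ ∈ charAlg n) (m : ℕ) :
    ∃ ψ ∈ complexify (RegularFunctions.algebra (Y := CharVar n m)),
      ∀ ρ : Rep n m, ψ ρ.cls = φ ⟨m, ρ⟩ := by
  induction hφ using Algebra.adjoin_induction with
  | mem φ hφ =>
    obtain ⟨γ, rfl⟩ := hφ
    have h : (fun ρ : Rep n m => chi γ ⟨m, ρ⟩) ∈
        complexify (RegularFunctions.algebra (Y := Rep n m)) := by
      have h := Subalgebra.sum_mem _ fun (i : Fin m) (_ : i ∈ Finset.univ) =>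
        mat_mem_complexify γ i i
      convert h using 1
      ext ρ
      simp [chi, Matrix.trace]
    refine ⟨Quotient.lift (fun ρ : Rep n m => chi γ ⟨m, ρ⟩) fun ρ σ h =>
      chi_eq_of_cls_eq (Quotient.sound h) γ, ⟨h.1, h.2⟩, fun ρ => rfl⟩
  | algebraMap c => exact ⟨algebraMap ℂ _ c, Subalgebra.algebraMap_mem _ c, fun ρ => rfl⟩
  | add φ₁ φ₂ _ _ h₁ h₂ =>
    obtain ⟨ψ₁, hψ₁, h₁⟩ := h₁
    obtain ⟨ψ₂, hψ₂, h₂⟩ := h₂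
    exact ⟨ψ₁ + ψ₂, add_mem hψ₁ hψ₂, fun ρ => by simp [h₁, h₂]⟩
  | mul φ₁ φ₂ _ _ h₁ h₂ =>
    obtain ⟨ψ₁, hψ₁, h₁⟩ := h₁
    obtain ⟨ψ₂, hψ₂, h₂⟩ := h₂
    exact ⟨ψ₁ * ψ₂, mul_mem hψ₁ hψ₂, fun ρ => by simp [h₁, h₂]⟩

/-! ### Regular functions on families of irreducible representations -/

/-- The real polynomials in the real and imaginary parts of the matrix entries. -/
def irrAlg (n : ℕ) {s : ℕ} (d a : Fin s → ℕ) : Subalgebra ℝ (IrrTup n d a → ℝ) where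
  carrier := {f | ∃ F ∈ entryAlg n fun p : (Σ i, Fin (a i)) => d p.1, ∀ y, (f y : ℂ) = F y.tup}
  mul_mem' := by
    rintro f g ⟨F, hF, h⟩ ⟨G, hG, h'⟩
    exact ⟨F * G, mul_mem hF hG, fun y => by simp [h, h']⟩
  add_mem' := by
    rintro f g ⟨F, hF, h⟩ ⟨G, hG, h'⟩
    exact ⟨F + G, add_mem hF hG, fun y => by simp [h, h']⟩
  algebraMap_mem' := fun c => ⟨algebraMap ℂ _ c, Subalgebra.algebraMap_mem _ _, fun y => rfl⟩

theorem re_mem_irrAlg {F : Tup n d a → ℂ} (hF : F ∈ entryAlg n fun p : (Σ i, Fin (a i)) => d p.1) :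
    (fun y : IrrTup n d a => (F y.tup).re) ∈ irrAlg n d a :=
  ⟨(2 : ℂ)⁻¹ • (F + star F), Subalgebra.smul_mem _ (add_mem hF (star_mem_entryAlg hF)) _,
    fun y => by simp [Complex.re_eq_add_conj, div_eq_inv_mul]⟩

theorem im_mem_irrAlg {F : Tup n d a → ℂ} (hF : F ∈ entryAlg n fun p : (Σ i, Fin (a i)) => d p.1) :
    (fun y : IrrTup n d a => (F y.tup).im) ∈ irrAlg n d a :=
  ⟨(2 * Complex.I)⁻¹ • (F - star F), Subalgebra.smul_mem _ (sub_mem hF (star_mem_entryAlg hF)) _,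
    fun y => by simp only [Complex.im_eq_sub_conj, div_eq_inv_mul]; rfl⟩

theorem comp_mem_irrAlg {m : ℕ} {φ : IrrTup n d a → Rep n m}
    (h : ∀ j k l, ∃ F ∈ entryAlg n fun p : (Σ i, Fin (a i)) => d p.1,
      ∀ y, (φ y).mat (gen n j) k l = F y.tup) {f : Rep n m → ℝ} (hf : IsRegular f) :
    f ∘ φ ∈ localFractions (irrAlg n d a) := by
  refine comp_mem_localFractions (fun f hf => le_localFractions (comp_mem_of_adjoin ?_ hf)) hf
  rintro _ (⟨j, k, l, rfl⟩ | ⟨j, k, l, rfl⟩)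
  · obtain ⟨F, hF, H⟩ := h j k l
    convert re_mem_irrAlg hF using 1
    ext y
    exact congrArg Complex.re (H y)
  · obtain ⟨F, hF, H⟩ := h j k l
    convert im_mem_irrAlg hF using 1
    ext y
    exact congrArg Complex.im (H y)

theorem comp_sumClass_mem (e : (Σ p : (Σ i, Fin (a i)), Fin (d p.1)) ≃ Fin r)
    {f : stratum n r d a → ℝ} (hf : IsRegular f) :
    f ∘ sumClass e ∈ localFractions (irrAlg n d a) := by
  refine comp_mem_localFractions ?_ hf
  rintro _ ⟨f, hf, rfl⟩
  refine comp_mem_irrAlg (φ := fun y => directSum e y.tup) (fun j k l => ?_)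
    (show IsRegular (f ∘ Rep.cls) from hf)
  simp only [mat_directSum, Matrix.submatrix_apply]
  obtain ⟨p, k⟩ := e.symm k
  obtain ⟨q, l⟩ := e.symm l
  by_cases hpq : p = q
  · subst hpq
    refine ⟨_, Algebra.subset_adjoin ⟨p, gen n j, k, l, rfl⟩, fun y => ?_⟩
    rw [Matrix.blockDiagonal'_apply_eq]
    rfl
  · exact ⟨0, Subalgebra.zero_mem _, fun y => Matrix.blockDiagonal'_apply_ne _ _ _ hpq⟩

theorem comp_irrCls_mem (p : Σ i, Fin (a i)) {f : irrLocus n (d p.1) → ℝ} (hf : IsRegular f) :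
    (fun y : IrrTup n d a => f (irrCls (y p).1 (y p).2)) ∈ localFractions (irrAlg n d a) := by
  refine comp_mem_localFractions (φ := fun y : IrrTup n d a => irrCls (y p).1 (y p).2) ?_ hf
  rintro _ ⟨f, hf, rfl⟩
  exact comp_mem_irrAlg (φ := fun y => y.tup p)
    (fun j k l => ⟨_, Algebra.subset_adjoin ⟨p, gen n j, k, l, rfl⟩, fun y => rfl⟩)
    (show IsRegular (f ∘ Rep.cls) from hf)

theorem comp_localFractions_adjoin_mem {κ : Type*} {Y : κ → Type*} [∀ k, RegularFunctions (Y k)]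
    {X : Type*} {𝒜 : Subalgebra ℝ (X → ℝ)} {φ : X → ∀ k, Y k}
    (h : ∀ k (f : Y k → ℝ), IsRegular f → (fun x => f (φ x k)) ∈ localFractions 𝒜)
    {f : (∀ k, Y k) → ℝ} (hf : IsRegular f) : f ∘ φ ∈ localFractions 𝒜 := by
  refine comp_mem_localFractions (fun f hf => comp_mem_of_adjoin ?_ hf) hf
  rintro _ ⟨k, f, hf, rfl⟩
  exact h k f hf

theorem comp_symClass_mem {f : (∀ i, SymProd (irrLocus n (d i)) (a i)) → ℝ} (hf : IsRegular f) :
    f ∘ symClass ∈ localFractions (irrAlg n d a) := by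
  refine comp_localFractions_adjoin_mem (fun i f hf => ?_) hf
  exact comp_localFractions_adjoin_mem
    (φ := fun y : IrrTup n d a => fun l => irrCls (y ⟨i, l⟩).1 (y ⟨i, l⟩).2)
    (fun l f hf => comp_irrCls_mem ⟨i, l⟩ hf)
    (show IsRegular (f ∘ Quotient.mk (permSetoid (irrLocus n (d i)) (a i))) from hf)

theorem tup_injective : Function.Injective (IrrTup.tup (n := n) (d := d) (a := a)) :=
  fun _ _ h => funext fun p => Subtype.ext (congrFun h p)

/-- The extension by zero to all families. -/
noncomputable def extendZero (f : IrrTup n d a → ℝ) : Tup n d a → ℂ :=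
  Function.extend IrrTup.tup (fun y => (f y : ℂ)) 0

theorem extendZero_tup (f : IrrTup n d a → ℝ) (y : IrrTup n d a) : extendZero f y.tup = f y :=
  tup_injective.extend_apply _ _ _

theorem extendZero_mem_fracAt {f : IrrTup n d a → ℝ} (hf : f ∈ localFractions (irrAlg n d a))
    (y₀ : IrrTup n d a) : extendZero f ∈ fracAt (entryAlg n fun p : (Σ i, Fin (a i)) => d p.1)
      (Set.range IrrTup.tup) y₀.tup := by
  obtain ⟨P, ⟨P', hP', hP⟩, Q, ⟨Q', hQ', hQ⟩, h0, H⟩ := hf y₀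
  refine ⟨P', hP', Q', hQ', ?_, ?_⟩
  · rw [← hQ]
    exact_mod_cast h0
  · rintro _ ⟨y, rfl⟩
    rw [extendZero_tup, ← hP, ← hQ, ← H]
    push_cast
    rfl

/-! ### Invariance under conjugation and permutation -/

theorem symClass_conj (g : ∀ p : (Σ i, Fin (a i)), Matrix.unitaryGroup (Fin (d p.1)) ℂ)
    (y : IrrTup n d a) :
    symClass (fun p => ⟨(y p).1.conj (g p), isIrreducible_conj (y p).2 (g p)⟩ : IrrTup n d a) =
      symClass y :=
  (symClass_eq_iff.2 ⟨1, fun p => cls_eq_iff.2 ⟨g p, rfl⟩⟩).symm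

theorem symClass_perm (g : ∀ i, Equiv.Perm (Fin (a i))) (y : IrrTup n d a) :
    symClass (fun p => y ⟨p.1, g p.1 p.2⟩ : IrrTup n d a) = symClass y :=
  (symClass_eq_iff.2 ⟨g, fun _ => rfl⟩).symm

/-- The algebra generated by the symmetrised products of functions of characters. -/
def symAlg (n : ℕ) {s : ℕ} (d a : Fin s → ℕ) : Subalgebra ℂ (Tup n d a → ℂ) :=
  Algebra.adjoin ℂ {f | ∃ (i : Fin s) (φ : Fin (a i) → RepPt n → ℂ),
    (∀ l, φ l ∈ charAlg n) ∧ f = symSum i φ}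

/-- A monomial in the characters of the members is a product of one function per member, so its sum
over the product of symmetric groups factors into the `symSum` of the single dimensions. -/
theorem sum_perm_mem_symAlg {f : Tup n d a → ℂ}
    (hf : f ∈ famCharAlg n fun p : (Σ i, Fin (a i)) => d p.1) :
    (fun y => ∑ g : ∀ i, Equiv.Perm (Fin (a i)), f (y.perm g)) ∈ symAlg n d a := by
  let N : Submonoid (Tup n d a → ℂ) :=
    { carrier := {f | ∃ φ : (Σ i, Fin (a i)) → RepPt n → ℂ, (∀ p, φ p ∈ charAlg n) ∧
        f = fun y => ∏ p, φ p (y.pt p)}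
      one_mem' := ⟨1, fun _ => one_mem _, by ext; simp⟩
      mul_mem' := by
        rintro _ _ ⟨φ, hφ, rfl⟩ ⟨ψ, hψ, rfl⟩
        refine ⟨φ * ψ, fun p => mul_mem (hφ p) (hψ p), ?_⟩
        ext y
        simp [Finset.prod_mul_distrib] }
  have hle : Submonoid.closure {f : Tup n d a → ℂ | ∃ p γ, f = famChar p γ} ≤ N := by
    refine Submonoid.closure_le.2 ?_
    rintro _ ⟨p, γ, rfl⟩
    refine ⟨Function.update 1 p (chi γ), fun q => ?_, ?_⟩
    · by_cases hq : q = p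
      · subst hq; simpa using chi_mem_charAlg γ
      · rw [Function.update_of_ne hq]; exact one_mem _
    · ext y
      rw [Finset.prod_eq_single p]
      · simp only [Function.update_self]; rfl
      · intro q _ hq
        simp [Function.update_of_ne hq]
      · simp
  have hf' : f ∈ Submodule.span ℂ (N : Set (Tup n d a → ℂ)) := by
    refine Submodule.span_mono hle ?_
    rw [← Algebra.adjoin_eq_span]
    exact hf
  clear hf
  induction hf' using Submodule.span_induction with
  | mem f hf =>
    obtain ⟨φ, hφ, rfl⟩ := hf
    have h : ∏ i, symSum (d := d) i (fun l => φ ⟨i, l⟩) ∈ symAlg n d a :=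
      prod_mem fun i _ => Algebra.subset_adjoin ⟨i, _, fun l => hφ _, rfl⟩
    convert h using 1
    ext y
    rw [Finset.prod_apply]
    simp only [symSum, Fintype.prod_sigma]
    exact sum_pi_perm_prod a fun i l k => φ ⟨i, l⟩ (y.pt ⟨i, k⟩)
  | zero => simp only [Pi.zero_apply, Finset.sum_const_zero]; exact (symAlg n d a).zero_mem
  | add f g _ _ hf hg =>
    simp only [Pi.add_apply, Finset.sum_add_distrib]
    exact add_mem hf hg
  | smul c f _ hf =>
    simp only [Pi.smul_apply, ← Finset.smul_sum]
    exact (symAlg n d a).smul_mem hf c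

theorem star_mem_famCharAlg {κ : Type*} {D : κ → ℕ} {f : Fam n D → ℂ} (hf : f ∈ famCharAlg n D) :
    star f ∈ famCharAlg n D := by
  refine star_mem_adjoin ?_ hf
  rintro _ ⟨k, γ, rfl⟩
  refine Algebra.subset_adjoin ⟨k, γ⁻¹, ?_⟩
  ext y
  exact congrFun (star_chi γ) _

theorem extendZero_mem_fracAt_symAlg {g : (∀ i, SymProd (irrLocus n (d i)) (a i)) → ℝ}
    (hg : g ∘ symClass ∈ localFractions (irrAlg n d a)) (y₀ : IrrTup n d a) :
    extendZero (g ∘ symClass) ∈ fracAt (symAlg n d a) (Set.range IrrTup.tup) y₀.tup := by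
  have h1 : extendZero (g ∘ symClass) ∈
      fracAt (famCharAlg n fun p : (Σ i, Fin (a i)) => d p.1) (Set.range IrrTup.tup) y₀.tup := by
    refine mem_fracAt_famCharAlg (Set.mem_range_self y₀) ?_ y₀.spans ?_ (extendZero_mem_fracAt hg y₀)
    · rintro u _ ⟨y, rfl⟩
      exact ⟨fun p => ⟨(y p).1.conj (u p), isIrreducible_conj (y p).2 (u p)⟩, rfl⟩
    · rintro u _ ⟨y, rfl⟩
      have h := congrArg g (symClass_conj u y)
      rw [extendZero_tup]
      refine (extendZero_tup _
        (fun p => ⟨(y p).1.conj (u p), isIrreducible_conj (y p).2 (u p)⟩ : IrrTup n d a)).trans ?_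
      exact congrArg _ h
  obtain ⟨P, hP, Q, hQ, h0, H⟩ := h1
  refine fracAt_of_average (Set.mem_range_self y₀)
    (fun (u : ∀ i, Equiv.Perm (Fin (a i))) y => y.perm u) ?_ 1 rfl
    (le_fracAt (sum_perm_mem_symAlg (mul_mem hP (star_mem_famCharAlg hQ))))
    (le_fracAt (sum_perm_mem_symAlg (mul_mem hQ (star_mem_famCharAlg hQ)))) ?_ h0 H
  · rintro u _ ⟨y, rfl⟩
    exact ⟨fun p => y ⟨p.1, u p.1 p.2⟩, rfl⟩
  · rintro u _ ⟨y, rfl⟩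
    have h := congrArg g (symClass_perm u y)
    rw [extendZero_tup]
    refine (extendZero_tup _ (fun p => y ⟨p.1, u p.1 p.2⟩ : IrrTup n d a)).trans ?_
    exact congrArg _ h

/-! ### Descent -/

/-- Once numerator and denominator descend along the surjection `π`, so does the relation between
them; no statement about the geometry of `π` is needed. -/
theorem mem_localFractions_of_extendZero {Z : Type*} {π : IrrTup n d a → Z}
    (hπ : Function.Surjective π) {S : Subalgebra ℂ (Tup n d a → ℂ)} {𝒜 : Subalgebra ℝ (Z → ℝ)}
    (hS : ∀ F ∈ S, ∃ H ∈ complexify 𝒜, ∀ y, F y.tup = H (π y)) {f : Z → ℝ}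
    (hf : ∀ y₀ : IrrTup n d a, extendZero (f ∘ π) ∈ fracAt S (Set.range IrrTup.tup) y₀.tup) :
    f ∈ localFractions 𝒜 := by
  refine mem_localFractions_of_fracAt fun z₀ => ?_
  obtain ⟨y₀, rfl⟩ := hπ z₀
  obtain ⟨P, hP, Q, hQ, h0, H⟩ := hf y₀
  obtain ⟨P', hP', hPP'⟩ := hS P hP
  obtain ⟨Q', hQ', hQQ'⟩ := hS Q hQ
  refine ⟨P', hP', Q', hQ', hQQ' y₀ ▸ h0, fun z _ => ?_⟩
  obtain ⟨y, rfl⟩ := hπ z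
  rw [← hPP', ← hQQ', ← H _ ⟨y, rfl⟩, extendZero_tup]
  rfl

theorem exists_of_mem_adjoin {X Y Z : Type*} {τ : X → Y} {π : X → Z} {G : Set (Y → ℂ)}
    {B : Subalgebra ℂ (Z → ℂ)} (h : ∀ F ∈ G, ∃ H ∈ B, ∀ x, F (τ x) = H (π x)) {F : Y → ℂ}
    (hF : F ∈ Algebra.adjoin ℂ G) : ∃ H ∈ B, ∀ x, F (τ x) = H (π x) := by
  induction hF using Algebra.adjoin_induction with
  | mem F hF => exact h F hF
  | algebraMap c => exact ⟨algebraMap ℂ _ c, B.algebraMap_mem c, fun _ => rfl⟩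
  | add F₁ F₂ _ _ h₁ h₂ =>
    obtain ⟨H₁, hH₁, h₁⟩ := h₁
    obtain ⟨H₂, hH₂, h₂⟩ := h₂
    exact ⟨H₁ + H₂, add_mem hH₁ hH₂, fun x => by simp [h₁, h₂]⟩
  | mul F₁ F₂ _ _ h₁ h₂ =>
    obtain ⟨H₁, hH₁, h₁⟩ := h₁
    obtain ⟨H₂, hH₂, h₂⟩ := h₂
    exact ⟨H₁ * H₂, mul_mem hH₁ hH₂, fun x => by simp [h₁, h₂]⟩

theorem exists_symProd_of_charAlg (i : Fin s) {φ : Fin (a i) → RepPt n → ℂ}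
    (hφ : ∀ l, φ l ∈ charAlg n) :
    ∃ H ∈ complexify (RegularFunctions.algebra (Y := SymProd (irrLocus n (d i)) (a i))),
      ∀ y : IrrTup n d a, symSum i φ y.tup = H (symClass y i) := by
  choose ψ hψ hψφ using fun l => exists_regular_of_charAlg (hφ l) (d i)
  let H : (Fin (a i) → irrLocus n (d i)) → ℂ :=
    fun x => ∑ σ : Equiv.Perm (Fin (a i)), ∏ l, ψ l (x (σ l)).1
  have hfac : ∀ l k, (fun x : Fin (a i) → irrLocus n (d i) => ψ l (x k).1) ∈
      complexify (RegularFunctions.algebra (Y := Fin (a i) → irrLocus n (d i))) := by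
    intro l k
    refine comp_mem_complexify (φ := fun x : Fin (a i) → irrLocus n (d i) => (x k).1) ?_ (hψ l)
    intro f hf
    have h1 : IsRegular (f ∘ Subtype.val : irrLocus n (d i) → ℝ) := le_localFractions ⟨f, hf, rfl⟩
    exact le_localFractions (Algebra.subset_adjoin ⟨k, _, h1, rfl⟩)
  have hH : H ∈ complexify (RegularFunctions.algebra (Y := Fin (a i) → irrLocus n (d i))) := by
    have h := Subalgebra.sum_mem _ fun (σ : Equiv.Perm (Fin (a i))) (_ : σ ∈ Finset.univ) =>
      Subalgebra.prod_mem _ fun l (_ : l ∈ Finset.univ) => hfac l (σ l)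
    convert h using 1
    ext x
    simp [H]
  have hinv : ∀ x x', (permSetoid (irrLocus n (d i)) (a i)).r x x' → H x = H x' := by
    rintro x _ ⟨τ, rfl⟩
    exact (Equiv.sum_comp (Equiv.mulLeft τ) fun σ : Equiv.Perm (Fin (a i)) =>
      ∏ l, ψ l (x (σ l)).1).symm
  refine ⟨Quotient.lift H hinv, ⟨hH.1, hH.2⟩, fun y => ?_⟩
  refine Finset.sum_congr rfl fun σ _ => Finset.prod_congr rfl fun l _ => ?_
  exact (hψφ l _).symm

theorem isRegular_of_comp_symClass {g : (∀ i, SymProd (irrLocus n (d i)) (a i)) → ℝ}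
    (hg : g ∘ symClass ∈ localFractions (irrAlg n d a)) : IsRegular g := by
  refine mem_localFractions_of_extendZero symClass_surjective (fun F hF =>
    exists_of_mem_adjoin (τ := IrrTup.tup) ?_ hF) (extendZero_mem_fracAt_symAlg hg)
  rintro _ ⟨i, φ, hφ, rfl⟩
  obtain ⟨H, hH, h⟩ := exists_symProd_of_charAlg (d := d) i hφ
  refine ⟨fun z => H (z i), comp_mem_complexify
    (φ := fun z : (∀ i, SymProd (irrLocus n (d i)) (a i)) => z i) (fun f hf => ?_) hH, h⟩
  exact Algebra.subset_adjoin ⟨i, f, hf, rfl⟩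

/-- Invariance under permutations first gives fractions of symmetrised products; `symSum_mem_fracAt`
rewrites these through total characters, which are regular on the stratum. -/
theorem isRegular_of_comp_sumClass (hd : StrictAnti d) (hpos : ∀ i, 0 < d i)
    (e : (Σ p : (Σ i, Fin (a i)), Fin (d p.1)) ≃ Fin r) {f : stratum n r d a → ℝ}
    {g : (∀ i, SymProd (irrLocus n (d i)) (a i)) → ℝ} (hfg : f ∘ sumClass e = g ∘ symClass)
    (hg : g ∘ symClass ∈ localFractions (irrAlg n d a)) : IsRegular f := by
  refine mem_localFractions_of_extendZero (sumClass_surjective e) (S := totalAlg n d a) (fun F hF =>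
    exists_of_mem_adjoin (τ := IrrTup.tup) ?_ hF) fun y₀ => ?_
  · rintro _ ⟨γ, rfl⟩
    obtain ⟨ψ, hψ, h⟩ := exists_regular_of_charAlg (chi_mem_charAlg γ) r
    refine ⟨_, comp_mem_complexify (φ := fun z : stratum n r d a => z.1)
      (fun f hf => Subalgebra.mem_map.2 ⟨f, hf, rfl⟩) hψ, fun y => ?_⟩
    exact ((h _).trans (chi_directSum e y.tup γ)).symm
  · rw [hfg]
    refine fracAt_le_fracAt (Set.mem_range_self y₀) (Algebra.adjoin_le ?_) (extendZero_mem_fracAt_symAlg hg y₀)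
    rintro _ ⟨i, φ, hφ, rfl⟩
    exact fracAt_anti (Set.subset_univ _) (symSum_mem_fracAt hd hpos y₀.spans i φ hφ)

/-- On either side a function is regular exactly when its pullback to tuples of irreducible
representations is a local fraction of polynomials in the entries, and the two pullbacks coincide.
-/
theorem strataHomeomorph_isBiregular (hd : StrictAnti d) (hpos : ∀ i, 0 < d i)
    (e : (Σ p : (Σ i, Fin (a i)), Fin (d p.1)) ≃ Fin r) :
    IsBiregular (strataHomeomorph (n := n) hd hpos e).toEquiv := by
  intro f
  have h : f ∘ sumClass e = (f ∘ (strataHomeomorph (n := n) hd hpos e).toEquiv) ∘ symClass := by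
    ext y
    exact congrArg f (strataEquiv_symClass hd hpos e y).symm
  refine ⟨fun hf => ?_, fun hf => isRegular_of_comp_sumClass hd hpos e h (comp_symClass_mem hf)⟩
  refine isRegular_of_comp_symClass ?_
  rw [← h]
  exact comp_sumClass_mem e hf

end TwistedHopf

theorem mainTheorem5 (n r : ℕ) (hn : 1 ≤ n) (hr : 1 ≤ r) (s : ℕ) (d a : Fin s → ℕ)
    (hd : StrictAnti d) (hpos : ∀ i, 0 < d i) (hsum : ∑ i, a i * d i = r) :
    ∃ Φ : (∀ i, TwistedHopf.SymProd (TwistedHopf.irrLocus n (d i)) (a i)) ≃ₜ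
        TwistedHopf.stratum n r d a,
      TwistedHopf.IsBiregular Φ.toEquiv ∧
      ∀ (ρ : ∀ p : (Σ i, Fin (a i)), TwistedHopf.Rep n (d p.1))
        (hρ : ∀ p, (ρ p).IsIrreducible)
        (e : (Σ p : (Σ i, Fin (a i)), Fin (d p.1)) ≃ Fin r),
        (Φ fun i => Quotient.mk (TwistedHopf.permSetoid (TwistedHopf.irrLocus n (d i)) (a i))
            fun l => TwistedHopf.irrCls (ρ ⟨i, l⟩) (hρ ⟨i, l⟩) :
          TwistedHopf.CharVar n r) = (TwistedHopf.directSum e ρ).cls := by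
  have hcard : Fintype.card (Σ p : (Σ i, Fin (a i)), Fin (d p.1)) = r := by
    simp [Fintype.card_sigma, Fintype.sum_sigma, hsum]
  -- Any numbering of the basis will do, since another one changes the sum by a conjugation.
  let e₀ := Fintype.equivFinOfCardEq hcard
  refine ⟨TwistedHopf.strataHomeomorph hd hpos e₀,
    TwistedHopf.strataHomeomorph_isBiregular hd hpos e₀, fun ρ hρ e => ?_⟩
  let y : TwistedHopf.IrrTup n d a := fun p => ⟨ρ p, hρ p⟩
  exact (Subtype.ext_iff.1 (TwistedHopf.strataEquiv_symClass hd hpos e₀ y)).trans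
    (TwistedHopf.cls_directSum_eq_of_symClass_eq (y := y) (y' := y) e₀ e rfl)
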